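/- Let $\mathbb S^2_{\mathcal C}$ be the double covering of $\mathbb S^2\setminus\{\text{North},\text{South}\}$, described by spherical coordinates $\theta\in(0,\pi)$, $\phi\in\mathbb R/4\pi\mathbb Z$, with deck transformation $\mathcal I:(\theta,\phi)\mapsto(\theta,\phi+2\pi)$. Its Laplace–Beltrami operator $H$ is the Friedrichs extension in $L^2(\sin\theta\,d\theta\,d\phi)$ of $$\mathbf L^2=-\frac1{\sin^2\theta}\frac{\partial^2}{\partial\phi^2}-\frac1{\sin\theta}\frac{\partial}{\partial\theta}\sin\theta\frac{\partial}{\partial\theta}$$ defined on $C_c^\infty(\mathbb S^2_{\mathcal C})$. For $\ell\in\frac12\mathbb N=\{0,\frac12,1,\dots\}$ and $m\in\{-\ell,-\ell+1,\dots,\ell\}$ put, if $m\ge0$, $$Y_{\ell,m}(\theta,\phi)=c_{\ell,m}\,e^{im\phi}\,\frac1{\sin^m\theta}\Bigl(-\frac1{\sin\theta}\frac{d}{d\theta}\Bigr)^{\ell-m}\sin^{2\ell}\theta ,$$ where $c_{\ell,m}>0$ normalizes $Y_{\ell,m}$ in $L^2(\sin\theta\,d\theta\,d\phi)$, and, if $m<0$,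 $Y_{\ell,m}=\hat c_{\ell,m}\,\overline{Y_{\ell,-m}}$ with arbitrary constants $\hat c_{\ell,m}$ of modulus $1$. Then: 1. The spectrum of $H$ is $\{\ell(\ell+1):\ell\in\frac12\mathbb N\}$. 2. For each $\ell\in\frac12\mathbb N$, $\ell(\ell+1)$ is an eigenvalue of multiplicity $2\ell+1$. 3. For each $\ell\in\frac12\mathbb N$, the functions $Y_{\ell,m}$, $m\in\{-\ell,\dots,\ell\}$, form an orthonormal basis of the eigenspace of $H$ for $\ell(\ell+1)$. 4. The third eigenvalue (in increasing order, counted with multiplicity) of the restriction of $H$ to the antisymmetric subspace $\{u: u\circ\mathcal I=-u\}$ is $\frac{15}4$. -/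

import Mathlib

open MeasureTheory
open scoped ContDiff InnerProductSpace

noncomputable section

/-! ### The double covering of the twice-punctured sphere -/

namespace HalfSphere

instance factFourPi : Fact (0 < 4 * Real.pi) := ⟨by positivity⟩

/-- Ambient space of the spherical coordinates `(θ, φ)` on the double covering, with `φ` taken
modulo `4π`.  The double covering itself is the open subset `domain`, given by `0 < θ < π`. -/
abbrev Coord : Type := ℝ × AddCircle (4 * Real.pi)

/-- The double covering of the sphere minus its poles: colatitude `θ ∈ (0, π)`, longitude
`φ ∈ ℝ / 4πℤ`. -/
def domain : Set Coord := Set.Ioo 0 Real.pi ×ˢ Set.univ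

/-- The covering projection
`(θ, φ) ↦ (sin θ cos φ, sin θ sin φ, cos θ)`; the monomial `fourier 2` is `exp (i φ)`. -/
def proj (p : Coord) : EuclideanSpace ℝ (Fin 3) :=
  !₂[Real.sin p.1 * (fourier (T := 4 * Real.pi) 2 p.2).re,
     Real.sin p.1 * (fourier (T := 4 * Real.pi) 2 p.2).im, Real.cos p.1]

/-- The deck transformation `φ ↦ φ + 2π`. -/
def deck (p : Coord) : Coord := (p.1, p.2 + ((2 * Real.pi : ℝ) : AddCircle (4 * Real.pi)))

/-- The Riemannian area measure `sin θ dθ dφ` of the double covering. -/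
def area : Measure Coord :=
  ((volume.restrict (Set.Ioo 0 Real.pi)).withDensity
    (fun θ : ℝ => ENNReal.ofReal (Real.sin θ))).prod (volume : Measure (AddCircle (4 * Real.pi)))

instance isFiniteMeasure_area : IsFiniteMeasure area := by
  have : IsFiniteMeasure ((volume.restrict (Set.Ioo 0 Real.pi)).withDensity
      (fun θ : ℝ => ENNReal.ofReal (Real.sin θ))) := by
    apply isFiniteMeasure_withDensity_ofReal
    have : IntegrableOn Real.sin (Set.Ioo 0 Real.pi) :=
      (Real.continuous_sin.integrableOn_Icc).mono_set Set.Ioo_subset_Icc_self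
    exact this.2
  unfold area
  infer_instance

lemma measurePreserving_deck : MeasurePreserving deck area area := by
  have h := (MeasurePreserving.id ((volume.restrict (Set.Ioo 0 Real.pi)).withDensity
    (fun θ : ℝ => ENNReal.ofReal (Real.sin θ)))).prod
    (measurePreserving_add_right (volume : Measure (AddCircle (4 * Real.pi)))
      ((2 * Real.pi : ℝ) : AddCircle (4 * Real.pi)))
  exact h

/-- The Hilbert space `L²(sin θ dθ dφ)` of the double covering. -/
abbrev L2 : Type := Lp ℂ 2 area

lemma fourier_two_coe (a : ℝ) :
    fourier (T := 4 * Real.pi) 2 (a : AddCircle (4 * Real.pi)) = Complex.exp (a * Complex.I) := by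
  rw [fourier_coe_apply]
  congr 1
  have : (Real.pi : ℂ) ≠ 0 := by exact_mod_cast Real.pi_ne_zero
  push_cast
  field_simp
  ring

/-- The projection is two-to-one on the double covering, with deck transformation `deck`. -/
lemma proj_eq_iff {p q : Coord} (hp : p ∈ domain) (hq : q ∈ domain) :
    proj p = proj q ↔ q = p ∨ q = deck p := by
  obtain ⟨t, x⟩ := p
  obtain ⟨s, y⟩ := q
  have ht : t ∈ Set.Ioo 0 Real.pi := hp.1
  have hs : s ∈ Set.Ioo 0 Real.pi := hq.1
  induction x using QuotientAddGroup.induction_on with | _ a =>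
  induction y using QuotientAddGroup.induction_on with | _ b =>
  change proj (t, (a : AddCircle (4 * Real.pi))) = proj (s, (b : AddCircle (4 * Real.pi))) ↔
    (s, (b : AddCircle (4 * Real.pi))) = (t, (a : AddCircle (4 * Real.pi))) ∨
    (s, (b : AddCircle (4 * Real.pi))) = deck (t, (a : AddCircle (4 * Real.pi)))
  constructor
  · intro h
    have h0 := congrArg (fun v : EuclideanSpace ℝ (Fin 3) => v 0) h
    have h1 := congrArg (fun v : EuclideanSpace ℝ (Fin 3) => v 1) h
    have h2 := congrArg (fun v : EuclideanSpace ℝ (Fin 3) => v 2) h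
    simp only [proj, fourier_two_coe] at h0 h1 h2
    simp at h0 h1 h2
    have hts : t = s := Real.injOn_cos ⟨ht.1.le, ht.2.le⟩ ⟨hs.1.le, hs.2.le⟩ h2
    subst hts
    have hsin : Real.sin t ≠ 0 := (Real.sin_pos_of_pos_of_lt_pi ht.1 ht.2).ne'
    have h0' := mul_left_cancel₀ hsin h0
    have h1' := mul_left_cancel₀ hsin h1
    have he : Complex.exp (b * Complex.I) = Complex.exp (a * Complex.I) := by
      apply Complex.ext
      · rw [Complex.exp_ofReal_mul_I_re, Complex.exp_ofReal_mul_I_re]; exact h0'.symm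
      · rw [Complex.exp_ofReal_mul_I_im, Complex.exp_ofReal_mul_I_im]; exact h1'.symm
    obtain ⟨n, hn⟩ := Complex.exp_eq_exp_iff_exists_int.1 he
    have hb : b = a + n * (2 * Real.pi) := by
      have := congrArg Complex.im hn
      simpa using this
    obtain ⟨k, hk⟩ | ⟨k, hk⟩ := Int.even_or_odd n
    · left
      refine Prod.ext rfl ?_
      rw [← sub_eq_zero, ← AddCircle.coe_sub, AddCircle.coe_eq_zero_iff]
      refine ⟨k, ?_⟩
      rw [hb, hk]
      simp only [zsmul_eq_mul]
      push_cast
      ring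
    · right
      refine Prod.ext rfl ?_
      simp only [deck, ← AddCircle.coe_add]
      rw [← sub_eq_zero, ← AddCircle.coe_sub, AddCircle.coe_eq_zero_iff]
      refine ⟨k, ?_⟩
      rw [hb, hk]
      simp only [zsmul_eq_mul]
      push_cast
      ring
  · rintro (h | h)
    · rw [h]
    · rw [h]
      simp only [deck, proj, ← AddCircle.coe_add, fourier_two_coe]
      have : Complex.exp (((a + 2 * Real.pi : ℝ) : ℂ) * Complex.I) = Complex.exp (a * Complex.I) := by
        push_cast
        rw [add_mul, Complex.exp_add, Complex.exp_two_pi_mul_I, mul_one]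
      rw [this]

/-! ### The Laplace–Beltrami operator on test functions -/

/-- A function on the double covering, written as a function of `(θ, φ) ∈ ℝ²`. -/
def lift (u : Coord → ℂ) (p : ℝ × ℝ) : ℂ := u (p.1, (p.2 : AddCircle (4 * Real.pi)))

/-- Test functions: smooth complex functions with compact support in the double covering. -/
def testFun : Submodule ℂ (Coord → ℂ) where
  carrier := {u | ContDiff ℝ ∞ (lift u) ∧ HasCompactSupport u ∧ tsupport u ⊆ domain}
  zero_mem' := by
    refine ⟨contDiff_const (c := (0 : ℂ)), HasCompactSupport.zero, ?_⟩
    simp [tsupport]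
  add_mem' := by
    rintro u v ⟨hu, hu', hu''⟩ ⟨hv, hv', hv''⟩
    exact ⟨hu.add hv, hu'.add hv', (tsupport_add u v).trans (Set.union_subset hu'' hv'')⟩
  smul_mem' := by
    rintro c u ⟨hu, hu', hu''⟩
    refine ⟨hu.const_smul c, hu'.smul_left (f := fun _ => c), ?_⟩
    exact (closure_mono (Function.support_const_smul_subset c u)).trans hu''

/-- `∂u/∂θ`. -/
def dTheta (u : Coord → ℂ) (p : Coord) : ℂ := deriv (fun s : ℝ => u (s, p.2)) p.1

/-- `∂u/∂φ`. -/
def dPhi (u : Coord → ℂ) (p : Coord) : ℂ :=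
  deriv (fun s : ℝ => u (p.1, p.2 + (s : AddCircle (4 * Real.pi)))) 0

/-- Multiplication by a function of the colatitude. -/
def mulTheta (w : ℝ → ℝ) (u : Coord → ℂ) (p : Coord) : ℂ := (w p.1 : ℂ) * u p

lemma dTheta_coe (u : Coord → ℂ) (h : ContDiff ℝ ∞ (lift u)) (q : ℝ × ℝ) :
    HasDerivAt (fun s : ℝ => u (s, (q.2 : AddCircle (4 * Real.pi))))
      (fderiv ℝ (lift u) q (1, 0)) q.1 := by
  have h1 : HasFDerivAt (lift u) (fderiv ℝ (lift u) q) (q.1, q.2) :=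
    ((h.differentiable (by simp)) q).hasFDerivAt
  have h2 : HasDerivAt (fun s : ℝ => (s, q.2)) ((1 : ℝ), (0 : ℝ)) q.1 :=
    (hasDerivAt_id q.1).prodMk (hasDerivAt_const q.1 q.2)
  exact h1.comp_hasDerivAt q.1 h2

lemma dPhi_coe (u : Coord → ℂ) (h : ContDiff ℝ ∞ (lift u)) (q : ℝ × ℝ) :
    HasDerivAt (fun s : ℝ => u (q.1, (q.2 : AddCircle (4 * Real.pi)) +
      (s : AddCircle (4 * Real.pi)))) (fderiv ℝ (lift u) q (0, 1)) 0 := by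
  have h1 : HasFDerivAt (lift u) (fderiv ℝ (lift u) q) (q.1, q.2 + 0) := by
    rw [add_zero]
    exact ((h.differentiable (by simp)) q).hasFDerivAt
  have h2 : HasDerivAt (fun s : ℝ => (q.1, q.2 + s)) ((0 : ℝ), (1 : ℝ)) 0 :=
    (hasDerivAt_const (0 : ℝ) q.1).prodMk ((hasDerivAt_id (0 : ℝ)).const_add q.2)
  exact h1.comp_hasDerivAt (0 : ℝ) h2

lemma contDiff_fderiv_lift {u : Coord → ℂ} (h : ContDiff ℝ ∞ (lift u)) (v : ℝ × ℝ) :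
    ContDiff ℝ ∞ (fun q => fderiv ℝ (lift u) q v) :=
  (h.fderiv_right (m := ∞) (by simp)).clm_apply contDiff_const

lemma continuous_of_lift {u : Coord → ℂ} (h : Continuous (lift u)) : Continuous u := by
  have hq : IsOpenQuotientMap (Prod.map (id : ℝ → ℝ)
      (fun s : ℝ => (s : AddCircle (4 * Real.pi)))) :=
    IsOpenQuotientMap.id.prodMap QuotientAddGroup.isOpenQuotientMap_mk
  exact hq.isQuotientMap.continuous_iff.2 h

/-- An operator that does not enlarge the support preserves its compactness and inclusion. -/
lemma testFun_of_support {u v : Coord → ℂ} (hu : u ∈ testFun) (hv : ContDiff ℝ ∞ (lift v))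
    (h : Function.support v ⊆ tsupport u) : v ∈ testFun :=
  ⟨hv, hu.2.1.mono' h, (closure_minimal h (isClosed_tsupport u)).trans hu.2.2⟩

lemma dTheta_mem {u : Coord → ℂ} (hu : u ∈ testFun) : dTheta u ∈ testFun := by
  refine testFun_of_support hu ?_ ?_
  · have : lift (dTheta u) = fun q => fderiv ℝ (lift u) q (1, 0) :=
      funext fun q => (dTheta_coe u hu.1 q).deriv
    rw [this]
    exact contDiff_fderiv_lift hu.1 _
  · intro p hp
    by_contra hn
    apply hp
    have h0 : u =ᶠ[nhds p] 0 := notMem_tsupport_iff_eventuallyEq.1 hn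
    have hc : Filter.Tendsto (fun s : ℝ => (s, p.2)) (nhds p.1) (nhds p) :=
      Continuous.tendsto (f := fun s : ℝ => (s, p.2)) (by fun_prop) p.1
    have h1 : (fun s : ℝ => u (s, p.2)) =ᶠ[nhds p.1] fun _ => 0 := hc.eventually h0
    unfold dTheta
    rw [h1.deriv_eq]
    simp

lemma dPhi_mem {u : Coord → ℂ} (hu : u ∈ testFun) : dPhi u ∈ testFun := by
  refine testFun_of_support hu ?_ ?_
  · have : lift (dPhi u) = fun q => fderiv ℝ (lift u) q (0, 1) :=
      funext fun q => (dPhi_coe u hu.1 q).deriv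
    rw [this]
    exact contDiff_fderiv_lift hu.1 _
  · intro p hp
    by_contra hn
    apply hp
    have h0 : u =ᶠ[nhds p] 0 := notMem_tsupport_iff_eventuallyEq.1 hn
    have hc : Filter.Tendsto (fun s : ℝ => (p.1, p.2 + (s : AddCircle (4 * Real.pi))))
        (nhds 0) (nhds p) := by
      have := Continuous.tendsto (f := fun s : ℝ => (p.1, p.2 + (s : AddCircle (4 * Real.pi))))
        (by have := AddCircle.continuous_mk' (4 * Real.pi); fun_prop) 0
      simpa using this
    have h1 : (fun s : ℝ => u (p.1, p.2 + (s : AddCircle (4 * Real.pi)))) =ᶠ[nhds 0]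
      fun _ => 0 := hc.eventually h0
    unfold dPhi
    rw [h1.deriv_eq]
    simp

lemma mulTheta_mem {w : ℝ → ℝ} (hw : ContDiffOn ℝ ∞ w (Set.Ioo 0 Real.pi)) {u : Coord → ℂ}
    (hu : u ∈ testFun) : mulTheta w u ∈ testFun := by
  refine testFun_of_support hu ?_ ?_
  · rw [contDiff_iff_contDiffAt]
    intro q
    by_cases hq : q.1 ∈ Set.Ioo 0 Real.pi
    · have h1 : ContDiffAt ℝ ∞ (fun q : ℝ × ℝ => (w q.1 : ℂ)) q := by
        have h2 : ContDiffAt ℝ ∞ w q.1 := hw.contDiffAt (isOpen_Ioo.mem_nhds hq)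
        have h3 : ContDiffAt ℝ ∞ (fun q : ℝ × ℝ => w q.1) q := h2.comp q contDiffAt_fst
        exact Complex.ofRealCLM.contDiff.contDiffAt.comp q h3
      exact h1.mul hu.1.contDiffAt
    · have hn : ((q.1, (q.2 : AddCircle (4 * Real.pi))) : Coord) ∉ tsupport u :=
        fun h => hq (hu.2.2 h).1
      have h0 := notMem_tsupport_iff_eventuallyEq.1 hn
      have hc : Filter.Tendsto (fun r : ℝ × ℝ => ((r.1, (r.2 : AddCircle (4 * Real.pi))) : Coord))
          (nhds q) (nhds (q.1, (q.2 : AddCircle (4 * Real.pi)))) :=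
        Continuous.tendsto
          (f := fun r : ℝ × ℝ => ((r.1, (r.2 : AddCircle (4 * Real.pi))) : Coord))
          (by have := AddCircle.continuous_mk' (4 * Real.pi); fun_prop) q
      have h1 : lift (mulTheta w u) =ᶠ[nhds q] fun _ => 0 := by
        filter_upwards [hc.eventually h0] with r hr
        have : u (r.1, (r.2 : AddCircle (4 * Real.pi))) = 0 := hr
        simp [lift, mulTheta, this]
      exact contDiffAt_const.congr_of_eventuallyEq h1
  · intro p hp
    apply subset_tsupport u
    intro h0
    exact hp (by simp [mulTheta, h0])

/-- `∂/∂θ` as an operator on test functions. -/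
def dThetaTest : testFun →ₗ[ℂ] testFun where
  toFun u := ⟨dTheta u.1, dTheta_mem u.2⟩
  map_add' u v := by
    ext p
    obtain ⟨t, x⟩ := p
    induction x using QuotientAddGroup.induction_on with | _ a =>
    exact ((dTheta_coe u.1 u.2.1 (t, a)).add (dTheta_coe v.1 v.2.1 (t, a))).deriv.trans
      (congrArg₂ (· + ·) (dTheta_coe u.1 u.2.1 (t, a)).deriv.symm
        (dTheta_coe v.1 v.2.1 (t, a)).deriv.symm)
  map_smul' c u := by
    ext p
    obtain ⟨t, x⟩ := p
    induction x using QuotientAddGroup.induction_on with | _ a =>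
    exact ((dTheta_coe u.1 u.2.1 (t, a)).const_smul c).deriv.trans
      (congrArg (c • ·) (dTheta_coe u.1 u.2.1 (t, a)).deriv.symm)

/-- `∂/∂φ` as an operator on test functions. -/
def dPhiTest : testFun →ₗ[ℂ] testFun where
  toFun u := ⟨dPhi u.1, dPhi_mem u.2⟩
  map_add' u v := by
    ext p
    obtain ⟨t, x⟩ := p
    induction x using QuotientAddGroup.induction_on with | _ a =>
    exact ((dPhi_coe u.1 u.2.1 (t, a)).add (dPhi_coe v.1 v.2.1 (t, a))).deriv.trans
      (congrArg₂ (· + ·) (dPhi_coe u.1 u.2.1 (t, a)).deriv.symm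
        (dPhi_coe v.1 v.2.1 (t, a)).deriv.symm)
  map_smul' c u := by
    ext p
    obtain ⟨t, x⟩ := p
    induction x using QuotientAddGroup.induction_on with | _ a =>
    exact ((dPhi_coe u.1 u.2.1 (t, a)).const_smul c).deriv.trans
      (congrArg (c • ·) (dPhi_coe u.1 u.2.1 (t, a)).deriv.symm)

/-- Multiplication by a function of `θ` that is smooth on `(0, π)`, on test functions. -/
def mulTest (w : ℝ → ℝ) (hw : ContDiffOn ℝ ∞ w (Set.Ioo 0 Real.pi)) : testFun →ₗ[ℂ] testFun where
  toFun u := ⟨mulTheta w u.1, mulTheta_mem hw u.2⟩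
  map_add' u v := by
    ext p
    exact mul_add _ _ _
  map_smul' c u := by
    ext p
    exact mul_left_comm _ _ _

lemma contDiffOn_sin : ContDiffOn ℝ ∞ Real.sin (Set.Ioo 0 Real.pi) :=
  Real.contDiff_sin.contDiffOn

lemma contDiffOn_inv_sin : ContDiffOn ℝ ∞ (fun θ => (Real.sin θ)⁻¹) (Set.Ioo 0 Real.pi) :=
  contDiffOn_sin.inv fun _ h => (Real.sin_pos_of_pos_of_lt_pi h.1 h.2).ne'

/-- The Laplace–Beltrami operator on test functions,
`-(sin θ)⁻² ∂²/∂φ² - (sin θ)⁻¹ ∂/∂θ (sin θ ∂/∂θ)`. -/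
def laplaceTest : testFun →ₗ[ℂ] testFun :=
  -(mulTest _ contDiffOn_inv_sin ∘ₗ mulTest _ contDiffOn_inv_sin ∘ₗ dPhiTest ∘ₗ dPhiTest)
  - mulTest _ contDiffOn_inv_sin ∘ₗ dThetaTest ∘ₗ mulTest _ contDiffOn_sin ∘ₗ dThetaTest

lemma laplaceTest_apply (u : testFun) (p : Coord) :
    (laplaceTest u : Coord → ℂ) p =
      -(1 / (Real.sin p.1 : ℂ) ^ 2) * dPhi (dPhi u) p
      - 1 / (Real.sin p.1 : ℂ) * dTheta (fun q => (Real.sin q.1 : ℂ) * dTheta u q) p := by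
  change -((((Real.sin p.1)⁻¹ : ℝ) : ℂ) * ((((Real.sin p.1)⁻¹ : ℝ) : ℂ) * dPhi (dPhi u) p))
    - (((Real.sin p.1)⁻¹ : ℝ) : ℂ) * dTheta (fun q => (Real.sin q.1 : ℂ) * dTheta u q) p = _
  push_cast
  ring

/-! ### The Friedrichs extension -/

lemma memLp_testFun (u : testFun) : MemLp (u : Coord → ℂ) 2 area :=
  (continuous_of_lift u.2.1.continuous).memLp_of_hasCompactSupport u.2.2.1

/-- A test function as an element of `L²`. -/
def toL2 : testFun →ₗ[ℂ] L2 where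
  toFun u := (memLp_testFun u).toLp
  map_add' _ _ := rfl
  map_smul' _ _ := rfl

/-- A test function with its Riemannian gradient `(∂u/∂θ, (sin θ)⁻¹ ∂u/∂φ)` in the orthonormal
frame.  On test functions `‖∂u/∂θ‖² + ‖(sin θ)⁻¹ ∂u/∂φ‖² = ⟨laplaceTest u, u⟩`, so the norm of
this map is the form norm of the Laplace–Beltrami operator. -/
def gradGraph : testFun →ₗ[ℂ] L2 × L2 × L2 :=
  toL2.prod ((toL2 ∘ₗ dThetaTest).prod (toL2 ∘ₗ mulTest _ contDiffOn_inv_sin ∘ₗ dPhiTest))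

/-- The form domain of the Friedrichs extension: the closure of the test functions in the form
norm, realised inside `L²`. -/
def formDomain : Submodule ℂ L2 :=
  (LinearMap.range gradGraph).topologicalClosure.map (LinearMap.fst ℂ L2 (L2 × L2))

/-- The graph of the Friedrichs extension: all pairs `(u, f)` with `u` in the form domain on which
the adjoint of the Laplace–Beltrami operator on test functions takes the value `f`. -/
def friedrichsGraph : Submodule ℂ (L2 × L2) where
  carrier := {p | p.1 ∈ formDomain ∧
    ∀ v : testFun, ⟪toL2 (laplaceTest v), p.1⟫_ℂ = ⟪toL2 v, p.2⟫_ℂ}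
  zero_mem' := ⟨zero_mem _, fun v => by simp⟩
  add_mem' := by
    rintro p q ⟨hp, hp'⟩ ⟨hq, hq'⟩
    refine ⟨add_mem hp hq, fun v => ?_⟩
    simp only [Prod.fst_add, Prod.snd_add, inner_add_right, hp' v, hq' v]
  smul_mem' := by
    rintro c p ⟨hp, hp'⟩
    refine ⟨Submodule.smul_mem _ c hp, fun v => ?_⟩
    simp only [Prod.smul_fst, Prod.smul_snd, inner_smul_right, hp' v]

/-- The Laplace–Beltrami operator of the double covering: the Friedrichs extension of the operator
on test functions, as a partially defined linear map whose graph is `friedrichsGraph`.  (That set is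
the graph of a map because the test functions are dense in `L²`.) -/
def laplacian : L2 →ₗ.[ℂ] L2 := friedrichsGraph.toLinearPMap

/-! ### Spectral notions for unbounded operators -/

section Spectral

variable {H : Type*} [NormedAddCommGroup H] [InnerProductSpace ℂ H]

/-- The spectrum of an unbounded operator `A`: the complement of the set of all `z` for which
`A - z` maps the domain of `A` bijectively onto the whole space, with bounded inverse. -/
def unboundedSpectrum (A : H →ₗ.[ℂ] H) : Set ℂ :=
  {z | ∃ R : H →L[ℂ] H,
    (∀ g : H, ∃ u : A.domain, (u : H) = R g ∧ A u - z • (u : H) = g) ∧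
    ∀ u : A.domain, R (A u - z • (u : H)) = u}ᶜ

/-- The eigenspace `{u ∈ dom A | A u = z u}`. -/
def eigenspace (A : H →ₗ.[ℂ] H) (z : ℂ) : Submodule ℂ H :=
  (LinearMap.ker (A.toFun - z • A.domain.subtype)).map A.domain.subtype

/-- `r` is the `k`-th eigenvalue of `A`, in increasing order and counted with multiplicity
(`k = 1` being the lowest one): the eigenvalues below `r` have total multiplicity less than `k`,
the eigenvalues up to `r` have total multiplicity at least `k`. -/
def IsKthEigenvalue (A : H →ₗ.[ℂ] H) (k : ℕ) (r : ℝ) : Prop :=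
  Module.rank ℂ (⨆ (s : ℝ) (_ : s < r), eigenspace A s : Submodule ℂ H) < k ∧
  k ≤ Module.rank ℂ (⨆ (s : ℝ) (_ : s ≤ r), eigenspace A s : Submodule ℂ H)

end Spectral

/-- The subspace of antisymmetric elements of `L²`: those with `u ∘ deck = -u`. -/
def antisymmetric : Submodule ℂ L2 :=
  LinearMap.ker (Lp.compMeasurePreservingₗ ℂ deck measurePreserving_deck + LinearMap.id)

/-- The Laplace–Beltrami operator restricted to the antisymmetric subspace. -/
def antisymmetricLaplacian : L2 →ₗ.[ℂ] L2 := laplacian.domRestrict antisymmetric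

/-! ### Spherical harmonics

Throughout `ℓ = n / 2` with `n : ℕ`, and `m = ℓ - q` with `q ∈ {0, …, n}`, so that `m` runs
through `{-ℓ, -ℓ + 1, …, ℓ}`. -/

/-- The operator `-(sin θ)⁻¹ d/dθ`. -/
def rodriguesOp (f : ℝ → ℝ) (θ : ℝ) : ℝ := -(1 / Real.sin θ) * deriv f θ

/-- `ψ_{ℓ,m}(θ) = (sin θ)^{-m} (-(sin θ)⁻¹ d/dθ)^{ℓ-m} (sin θ)^{2ℓ}`. -/
def psi (n q : ℕ) (θ : ℝ) : ℝ :=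
  1 / (Real.sin θ) ^ ((n : ℝ) / 2 - q) * (rodriguesOp^[q] fun t => Real.sin t ^ n) θ

/-- `exp (i m φ) ψ_{ℓ,m}(θ)`; on `ℝ / 4πℤ` the monomial `fourier k` is `exp (i (k / 2) φ)`, and
`2 m = n - 2 q`. -/
def harmonicCore (n q : ℕ) (p : Coord) : ℂ :=
  fourier (T := 4 * Real.pi) ((n : ℤ) - 2 * q) p.2 * (psi n q p.1 : ℂ)

/-- The normalized function `c_{ℓ,m} exp (i m φ) ψ_{ℓ,m}(θ)`, where `c_{ℓ,m} > 0` is the inverse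
of the `L²`-norm. -/
def normalizedCore (n q : ℕ) (p : Coord) : ℂ :=
  (((eLpNorm (harmonicCore n q) 2 area).toReal)⁻¹ : ℝ) * harmonicCore n q p

/-- The spherical harmonic `Y_{ℓ,m}`: for `m ≥ 0` it is `c_{ℓ,m} exp (i m φ) ψ_{ℓ,m}(θ)`, and for
`m < 0` it is the constant `ĉ` times the complex conjugate of `Y_{ℓ,-m}`
(replacing `m` by `-m` is replacing `q` by `n - q`). -/
def sphericalHarmonic (chat : ℕ → ℕ → ℂ) (n q : ℕ) (p : Coord) : ℂ :=
  if 2 * q ≤ n then normalizedCore n q p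
  else chat n q * (starRingEnd ℂ) (normalizedCore n (n - q) p)

end HalfSphere

end

noncomputable section

namespace HalfSphere

/-! ### Unbounded operators that are diagonal in a Hilbert basis -/

section Diagonal

variable {H : Type*} [NormedAddCommGroup H] [InnerProductSpace ℂ H]

/-! The operator is diagonalized by an explicit orthonormal basis, without any general theory of
Friedrichs extensions. The abstract core is `mem_diagonal_graph_iff`: a closed graph that contains
the eigenpairs of a Hilbert basis, and whose elements all satisfy the matching coefficient relation,
consists of all pairs satisfying that relation. The spectrum, the eigenspaces and their dimensions
are then read off from the list of eigenvalues.

Three facts feed this core. First, the Friedrichs graph is symmetric (`friedrichsGraph_symm`) and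
closed (`isClosed_friedrichsGraph`). Green's formula on test functions extends to the form domain,
where it gives symmetry; with both arguments equal it bounds the gradient by the graph norm, which
gives closedness.

Second, each harmonic is an eigenvector (`core_mem_friedrichsGraph`). With `x = cos θ` the Rodrigues
operator is `d/dx`, so the radial part is `(sin θ)^|m| Q(cos θ)` with `Q` a solution of a Gegenbauer
equation. Membership in the form domain is the delicate point: for `m = 0` the function need not
vanish at the poles, and for `|m| = 1/2` its gradient blows up like `(sin θ)^(-1/2)`. Logarithmic
cutoffs, which express that points have zero capacity in dimension two, approximate it by test
functions in the form norm (`IsAdmissible.mem_friedrichsGraph`).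

Third, the harmonics are complete (`eq_top_of_core_mem`). At a fixed frequency the polynomials `Q`
take every degree, so they span all polynomials. Weierstrass approximation, removal of the weight
`(sin θ)^|m|`, and Stone–Weierstrass in `(cos θ, φ)` then reach all of `L²`.

The deck transformation acts on the eigenspace of `ℓ = n / 2` as `(-1)^n`, so the antisymmetric part
retains exactly the odd `n`: `3/4` twice, then `15/4` four times. -/

lemma mem_eigenspace_iff {A : H →ₗ.[ℂ] H} {z : ℂ} {u : H} :
    u ∈ eigenspace A z ↔ (u, z • u) ∈ A.graph := by
  rw [LinearPMap.mem_graph_iff]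
  constructor
  · rintro ⟨y, hy, rfl⟩
    exact ⟨y, rfl, sub_eq_zero.1 hy⟩
  · rintro ⟨y, rfl, hy⟩
    exact ⟨y, sub_eq_zero.2 hy, rfl⟩

variable {ι : Type*}

lemma hilbertBasis_ext_inner {b : HilbertBasis ι ℂ H} {u v : H}
    (h : ∀ i, ⟪b i, u⟫_ℂ = ⟪b i, v⟫_ℂ) : u = v := by
  apply b.repr.injective
  ext i
  rw [b.repr_apply_apply, b.repr_apply_apply, h]

/-- A bounded multiplier acts coordinatewise on `ℓ²` and is transported by the coordinate isometry.
It supplies the resolvents. -/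
lemma exists_diagonal_operator (b : HilbertBasis ι ℂ H) (c : ι → ℂ) {K : ℝ} (hK : 0 ≤ K)
    (hc : ∀ i, ‖c i‖ ≤ K) :
    ∃ R : H →L[ℂ] H, ∀ g i, ⟪b i, R g⟫_ℂ = c i * ⟪b i, g⟫_ℂ := by
  have hn (i : ι) : ‖c i • ContinuousLinearMap.id ℂ ℂ‖ ≤ K := by
    rw [norm_smul]
    exact (mul_le_of_le_one_right (norm_nonneg _) ContinuousLinearMap.norm_id_le).trans (hc i)
  let T := lp.mapCLM (E := fun _ : ι => ℂ) (F := fun _ : ι => ℂ) 2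
    (fun i => c i • ContinuousLinearMap.id ℂ ℂ) hK hn
  refine ⟨(b.repr.symm : _ →L[ℂ] H) ∘L T ∘L (b.repr : H →L[ℂ] _), fun g i => ?_⟩
  rw [← b.repr_apply_apply, ← b.repr_apply_apply]
  simp [T]

variable {b : HilbertBasis ι ℂ H} {lam : ι → ℝ} {Γ : Submodule ℂ (H × H)}

/-- A closed graph which is diagonal in a Hilbert basis is determined by its eigenvalues. -/
lemma mem_diagonal_graph_iff (hcl : IsClosed (Γ : Set (H × H)))
    (h1 : ∀ i, (b i, (lam i : ℂ) • b i) ∈ Γ)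
    (h2 : ∀ p ∈ Γ, ∀ i, ⟪b i, p.2⟫_ℂ = lam i * ⟪b i, p.1⟫_ℂ) (p : H × H) :
    p ∈ Γ ↔ ∀ i, ⟪b i, p.2⟫_ℂ = lam i * ⟪b i, p.1⟫_ℂ := by
  refine ⟨h2 p, fun h => ?_⟩
  have e1 := b.hasSum_repr p.1
  have e2 := b.hasSum_repr p.2
  -- The partial sums of the two expansions, taken over the same finite set, are combinations of
  -- eigenpairs by the coefficient relation, so they stay in the graph.
  refine hcl.mem_of_tendsto (e1.prodMk e2) (Filter.Eventually.of_forall fun s => ?_)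
  refine Submodule.sum_mem _ fun i _ => ?_
  have : ((b.repr p.1 i • b i, b.repr p.2 i • b i) : H × H) =
      b.repr p.1 i • (b i, (lam i : ℂ) • b i) := by
    rw [b.repr_apply_apply, b.repr_apply_apply, h, Prod.smul_mk, smul_smul, mul_comm]
  rw [this]
  exact Γ.smul_mem _ (h1 i)

variable (hΓ : ∀ p : H × H, p ∈ Γ ↔ ∀ i, ⟪b i, p.2⟫_ℂ = lam i * ⟪b i, p.1⟫_ℂ)
include hΓ

/-- `Submodule.toLinearPMap` has the intended graph only when the relation is single-valued; here a
pair with first entry zero has second entry with all coefficients zero. -/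
lemma graph_toLinearPMap_of_diagonal : Γ.toLinearPMap.graph = Γ := by
  refine Submodule.toLinearPMap_graph_eq _ fun p hp h0 => ?_
  refine hilbertBasis_ext_inner (b := b) fun i => ?_
  rw [(hΓ p).1 hp i, h0, inner_zero_right, mul_zero]

lemma mem_eigenspace_of_diagonal {z : ℂ} {u : H} :
    u ∈ eigenspace Γ.toLinearPMap z ↔ ∀ i, (lam i : ℂ) ≠ z → ⟪b i, u⟫_ℂ = 0 := by
  rw [mem_eigenspace_iff, graph_toLinearPMap_of_diagonal hΓ, hΓ]
  refine forall_congr' fun i => ?_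
  rw [inner_smul_right, ← sub_eq_zero, ← sub_mul, mul_eq_zero, sub_eq_zero, eq_comm (a := z)]
  tauto

/-- If only finitely many eigenvalues coincide with `z`, the eigenspace is their span. -/
lemma eigenspace_eq_span {κ : Type*} [Fintype κ] {z : ℂ} (f : κ → ι)
    (hf : ∀ i, (lam i : ℂ) = z ↔ i ∈ Set.range f) :
    Submodule.span ℂ (Set.range fun k => b (f k)) = eigenspace Γ.toLinearPMap z := by
  classical
  apply le_antisymm
  · rw [Submodule.span_le]
    rintro _ ⟨k, rfl⟩
    refine (mem_eigenspace_of_diagonal hΓ).2 fun i hi => ?_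
    refine b.orthonormal.2 fun h => hi ?_
    exact (hf i).2 ⟨k, h.symm⟩
  · intro u hu
    rw [mem_eigenspace_of_diagonal hΓ] at hu
    have hs : HasSum (fun i => b.repr u i • b i) (∑ i ∈ Finset.univ.image f, b.repr u i • b i) := by
      refine hasSum_sum_of_ne_finset_zero fun i hi => ?_
      have : (lam i : ℂ) ≠ z := fun h => hi (by simpa using (hf i).1 h)
      rw [b.repr_apply_apply, hu i this, zero_smul]
    rw [(b.hasSum_repr u).unique hs]
    refine Submodule.sum_mem _ fun i hi => Submodule.smul_mem _ _ (Submodule.subset_span ?_)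
    obtain ⟨k, -, rfl⟩ := Finset.mem_image.1 hi
    exact ⟨k, rfl⟩

/-- Off the eigenvalues the resolvent is the multiplier `1 / (lam i - z)`, and `hgap` is what makes
it bounded. At an eigenvalue a left inverse would have to send `0` to a basis vector. -/
lemma unboundedSpectrum_of_diagonal
    (hgap : ∀ z : ℂ, (∀ i, (lam i : ℂ) ≠ z) → ∃ δ > 0, ∀ i, δ ≤ ‖(lam i : ℂ) - z‖) :
    unboundedSpectrum Γ.toLinearPMap = Set.range fun i => (lam i : ℂ) := by
  have hg := graph_toLinearPMap_of_diagonal hΓ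
  rw [unboundedSpectrum, ← compl_inj_iff, compl_compl]
  ext z
  simp only [Set.mem_ofPred_eq, Set.mem_compl_iff, Set.mem_range, not_exists]
  constructor
  · rintro ⟨R, -, hR⟩ i hi
    have hb : (b i, z • b i) ∈ Γ.toLinearPMap.graph := by
      rw [← mem_eigenspace_iff, mem_eigenspace_of_diagonal hΓ]
      exact fun j hj => b.orthonormal.2 fun h => hj (h ▸ hi)
    obtain ⟨y, hy, hy'⟩ := (LinearPMap.mem_graph_iff _).1 hb
    have := hR y
    simp only at hy hy'
    rw [hy', hy, sub_self, map_zero] at this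
    exact b.orthonormal.ne_zero i this.symm
  · intro hz
    obtain ⟨δ, hδ, hle⟩ := hgap z hz
    have hne (i : ι) : (lam i : ℂ) - z ≠ 0 := sub_ne_zero.2 (hz i)
    obtain ⟨R, hR⟩ := exists_diagonal_operator b (fun i => ((lam i : ℂ) - z)⁻¹)
      (inv_nonneg.2 hδ.le) (fun i => by rw [norm_inv]; exact inv_anti₀ hδ (hle i))
    refine ⟨R, fun g => ?_, fun u => ?_⟩
    · have : (R g, g + z • R g) ∈ Γ.toLinearPMap.graph := by
        rw [hg, hΓ]
        intro i
        have := hne i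
        rw [inner_add_right, inner_smul_right, hR]
        field_simp
        ring
      obtain ⟨y, hy, hy'⟩ := (LinearPMap.mem_graph_iff _).1 this
      simp only at hy hy'
      exact ⟨y, hy, by rw [hy', hy, add_sub_cancel_right]⟩
    · have hu := (hΓ _).1 (hg ▸ LinearPMap.mem_graph _ u)
      refine hilbertBasis_ext_inner (b := b) fun i => ?_
      rw [hR, inner_sub_right, inner_smul_right, hu i, ← sub_mul, inv_mul_cancel_left₀ (hne i)]

end Diagonal

/-! ### Green's formula on test functions -/

/-- The product `conj a * b` of two test functions. -/
def conjMul (a b : testFun) : testFun :=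
  ⟨fun p => (starRingEnd ℂ) ((a : Coord → ℂ) p) * (b : Coord → ℂ) p, by
    refine testFun_of_support b.2 ?_ ?_
    · have h1 : ContDiff ℝ ∞ (fun q => Complex.conjCLE (lift a.1 q)) :=
        Complex.conjCLE.contDiff.comp a.2.1
      exact h1.mul b.2.1
    · intro p hp
      apply subset_tsupport
      intro h
      exact hp (by simp [h])⟩

lemma dTheta_conjMul (a b : testFun) (p : Coord) :
    dTheta (conjMul a b) p = (starRingEnd ℂ) (dTheta a p) * (b : Coord → ℂ) p
      + (starRingEnd ℂ) ((a : Coord → ℂ) p) * dTheta b p := by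
  obtain ⟨t, x⟩ := p
  induction x using QuotientAddGroup.induction_on with | _ s =>
  have ha := dTheta_coe a.1 a.2.1 (t, s)
  have hb := dTheta_coe b.1 b.2.1 (t, s)
  have h := (Complex.conjCLE.hasFDerivAt.comp_hasDerivAt t ha).mul hb
  have e1 : dTheta a.1 (t, (s : AddCircle (4 * Real.pi))) = _ := ha.deriv
  have e2 : dTheta b.1 (t, (s : AddCircle (4 * Real.pi))) = _ := hb.deriv
  exact (h.deriv).trans (by rw [← e1, ← e2]; rfl)

lemma dPhi_conjMul (a b : testFun) (p : Coord) :
    dPhi (conjMul a b) p = (starRingEnd ℂ) (dPhi a p) * (b : Coord → ℂ) p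
      + (starRingEnd ℂ) ((a : Coord → ℂ) p) * dPhi b p := by
  obtain ⟨t, x⟩ := p
  induction x using QuotientAddGroup.induction_on with | _ s =>
  have ha := dPhi_coe a.1 a.2.1 (t, s)
  have hb := dPhi_coe b.1 b.2.1 (t, s)
  have h := (Complex.conjCLE.hasFDerivAt.comp_hasDerivAt 0 ha).mul hb
  have e1 : dPhi a.1 (t, (s : AddCircle (4 * Real.pi))) = _ := ha.deriv
  have e2 : dPhi b.1 (t, (s : AddCircle (4 * Real.pi))) = _ := hb.deriv
  refine (h.deriv).trans ?_
  rw [← e1, ← e2]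
  simp

lemma continuous_testFun (u : testFun) : Continuous (u : Coord → ℂ) :=
  continuous_of_lift u.2.1.continuous

lemma integrable_testFun (μ : Measure Coord) [IsFiniteMeasureOnCompacts μ] (u : testFun) :
    Integrable (u : Coord → ℂ) μ :=
  (continuous_testFun u).integrable_of_hasCompactSupport u.2.2.1

lemma testFun_eq_zero (u : testFun) {p : Coord} (hp : p.1 ∉ Set.Ioo 0 Real.pi) :
    (u : Coord → ℂ) p = 0 := by
  by_contra h
  exact hp (u.2.2.2 (subset_tsupport _ h)).1

/-- The fundamental theorem of calculus over one full period in `φ`: the two boundary values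
coincide. -/
lemma integral_dPhi (u : testFun) : ∫ p, dPhi u p ∂area = 0 := by
  have hi : Integrable (dPhi u) area := integrable_testFun area (dPhiTest u)
  rw [area] at hi ⊢
  rw [integral_prod _ hi]
  convert integral_zero ℝ ℂ with t
  rw [← AddCircle.intervalIntegral_preimage (4 * Real.pi) 0]
  have hd (s : ℝ) : HasDerivAt (fun s : ℝ => (u : Coord → ℂ) (t, (s : AddCircle (4 * Real.pi))))
      (dPhi u (t, (s : AddCircle (4 * Real.pi)))) s := by
    have h := dPhi_coe u.1 u.2.1 (t, s)
    have e : dPhi u.1 (t, (s : AddCircle (4 * Real.pi))) = _ := h.deriv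
    rw [e]
    have h' : HasDerivAt (fun r : ℝ => u.1 (t, (s : AddCircle (4 * Real.pi)) +
      (r : AddCircle (4 * Real.pi)))) (fderiv ℝ (lift u) (t, s) (0, 1)) (s - s) := by
      rw [sub_self]; exact h
    refine (h'.comp_sub_const s s).congr_of_eventuallyEq (Filter.Eventually.of_forall fun r => ?_)
    simp
  rw [intervalIntegral.integral_eq_sub_of_hasDerivAt (fun s _ => hd s)]
  · have : ((0 + 4 * Real.pi : ℝ) : AddCircle (4 * Real.pi)) = (0 : ℝ) := by
      rw [zero_add, AddCircle.coe_period, AddCircle.coe_zero]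
    rw [this, sub_self]
  · refine Continuous.intervalIntegrable ?_ _ _
    have := AddCircle.continuous_mk' (4 * Real.pi)
    exact (continuous_testFun (dPhiTest u)).comp (by fun_prop)

/-- The area measure has density `sin θ`. -/
lemma area_eq : area = ((volume.restrict (Set.Ioo 0 Real.pi)).prod
    (volume : Measure (AddCircle (4 * Real.pi)))).withDensity
      (fun p => ENNReal.ofReal (Real.sin p.1)) := by
  rw [area, prod_withDensity_left (by fun_prop)]

lemma ae_base : ∀ᵐ p ∂((volume.restrict (Set.Ioo 0 Real.pi)).prod
    (volume : Measure (AddCircle (4 * Real.pi)))), p.1 ∈ Set.Ioo 0 Real.pi :=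
  Measure.quasiMeasurePreserving_fst.ae (ae_restrict_mem measurableSet_Ioo)

lemma ae_area : ∀ᵐ p ∂area, p.1 ∈ Set.Ioo 0 Real.pi := by
  rw [area_eq]
  exact (withDensity_absolutelyContinuous _ _).ae_le ae_base

/-- The factor `1 / sin θ` cancels the density of the area measure, leaving the `θ`-derivative of a
compactly supported function. -/
lemma integral_dTheta (u : testFun) :
    ∫ p, (((Real.sin p.1)⁻¹ : ℝ) : ℂ) * dTheta u p ∂area = 0 := by
  rw [area_eq, integral_withDensity_eq_integral_toReal_smul (by fun_prop) (by simp)]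
  have h1 : ∫ p, (ENNReal.ofReal (Real.sin p.1)).toReal •
      ((((Real.sin p.1)⁻¹ : ℝ) : ℂ) * dTheta u p) ∂((volume.restrict (Set.Ioo 0 Real.pi)).prod
        (volume : Measure (AddCircle (4 * Real.pi)))) =
      ∫ p, dTheta u p ∂((volume.restrict (Set.Ioo 0 Real.pi)).prod
        (volume : Measure (AddCircle (4 * Real.pi)))) := by
    refine integral_congr_ae ?_
    filter_upwards [ae_base] with p hp
    have hs := Real.sin_pos_of_pos_of_lt_pi hp.1 hp.2
    rw [ENNReal.toReal_ofReal hs.le, Complex.real_smul, ← mul_assoc, ← Complex.ofReal_mul,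
      mul_inv_cancel₀ hs.ne', Complex.ofReal_one, one_mul]
  have hi : Integrable (dTheta u) ((volume.restrict (Set.Ioo 0 Real.pi)).prod
      (volume : Measure (AddCircle (4 * Real.pi)))) := integrable_testFun _ (dThetaTest u)
  rw [h1, integral_prod_symm _ hi]
  convert integral_zero (AddCircle (4 * Real.pi)) ℂ with x
  have hz (t : ℝ) (ht : t ∉ Set.Ioo 0 Real.pi) : dTheta u (t, x) = 0 :=
    testFun_eq_zero (dThetaTest u) (p := (t, x)) ht
  rw [setIntegral_eq_integral_of_forall_compl_eq_zero hz]
  have hc : Continuous (fun t : ℝ => ((t, x) : Coord)) := by fun_prop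
  have hemb : Topology.IsClosedEmbedding (fun t : ℝ => ((t, x) : Coord)) :=
    Topology.IsClosedEmbedding.of_continuous_injective_isClosedMap hc
      (fun a b h => congrArg Prod.fst h) (isClosedMap_prodMk_right x)
  refine integral_eq_zero_of_hasDerivAt_of_integrable (f := fun t => (u : Coord → ℂ) (t, x))
    (fun t => ?_) ?_ ?_
  · induction x using QuotientAddGroup.induction_on with | _ s =>
    exact (dTheta_coe u.1 u.2.1 (t, s)).differentiableAt.hasDerivAt
  · exact ((continuous_testFun (dThetaTest u)).comp hc).integrable_of_hasCompactSupport
      ((dThetaTest u).2.2.1.comp_isClosedEmbedding hemb)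
  · exact ((continuous_testFun u).comp hc).integrable_of_hasCompactSupport
      (u.2.2.1.comp_isClosedEmbedding hemb)

lemma inner_toLp {f g : Coord → ℂ} (hf : MemLp f 2 area) (hg : MemLp g 2 area) :
    ⟪hf.toLp, hg.toLp⟫_ℂ = ∫ p, (starRingEnd ℂ) (f p) * g p ∂area := by
  rw [L2.inner_def]
  refine integral_congr_ae ?_
  filter_upwards [hf.coeFn_toLp, hg.coeFn_toLp] with p h1 h2
  rw [h1, h2, RCLike.inner_apply, mul_comm]

lemma inner_toL2 (u v : testFun) :
    ⟪toL2 u, toL2 v⟫_ℂ = ∫ p, (starRingEnd ℂ) ((u : Coord → ℂ) p) * (v : Coord → ℂ) p ∂area :=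
  inner_toLp (memLp_testFun u) (memLp_testFun v)

lemma inner_dPhi (u v : testFun) :
    ⟪toL2 (dPhiTest u), toL2 v⟫_ℂ = -⟪toL2 u, toL2 (dPhiTest v)⟫_ℂ := by
  rw [eq_neg_iff_add_eq_zero, inner_toL2, inner_toL2, ← integral_add]
  · rw [← integral_dPhi (conjMul u v)]
    exact integral_congr_ae (Filter.Eventually.of_forall fun p => (dPhi_conjMul u v p).symm)
  · exact integrable_testFun area (conjMul (dPhiTest u) v)
  · exact integrable_testFun area (conjMul u (dPhiTest v))

/-- Because of the density `sin θ`, the derivative in `θ` is skew only after the weight `1 / sin θ`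
is inserted; this is the form in which it occurs in the Laplacian. -/
lemma inner_dTheta (u v : testFun) :
    ⟪toL2 (mulTest _ contDiffOn_inv_sin (dThetaTest u)), toL2 v⟫_ℂ =
      -⟪toL2 (mulTest _ contDiffOn_inv_sin u), toL2 (dThetaTest v)⟫_ℂ := by
  rw [eq_neg_iff_add_eq_zero, inner_toL2, inner_toL2, ← integral_add]
  · rw [← integral_dTheta (conjMul u v)]
    refine integral_congr_ae (Filter.Eventually.of_forall fun p => ?_)
    simp only [dTheta_conjMul]
    change (starRingEnd ℂ) ((((Real.sin p.1)⁻¹ : ℝ) : ℂ) * dTheta u p) * _ +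
      (starRingEnd ℂ) ((((Real.sin p.1)⁻¹ : ℝ) : ℂ) * (u : Coord → ℂ) p) * dTheta v p = _
    rw [map_mul, map_mul, Complex.conj_ofReal]
    ring
  · exact integrable_testFun area (conjMul (mulTest _ contDiffOn_inv_sin (dThetaTest u)) v)
  · exact integrable_testFun area (conjMul (mulTest _ contDiffOn_inv_sin u) (dThetaTest v))

lemma inner_mulTest (w : ℝ → ℝ) (hw : ContDiffOn ℝ ∞ w (Set.Ioo 0 Real.pi)) (u v : testFun) :
    ⟪toL2 (mulTest w hw u), toL2 v⟫_ℂ = ⟪toL2 u, toL2 (mulTest w hw v)⟫_ℂ := by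
  rw [inner_toL2, inner_toL2]
  refine integral_congr_ae (Filter.Eventually.of_forall fun p => ?_)
  change (starRingEnd ℂ) ((w p.1 : ℂ) * (u : Coord → ℂ) p) * _ =
    _ * ((w p.1 : ℂ) * (v : Coord → ℂ) p)
  rw [map_mul, Complex.conj_ofReal]
  ring

lemma dPhiTest_mulTest (w : ℝ → ℝ) (hw : ContDiffOn ℝ ∞ w (Set.Ioo 0 Real.pi)) (u : testFun) :
    dPhiTest (mulTest w hw u) = mulTest w hw (dPhiTest u) := by
  ext p
  obtain ⟨t, x⟩ := p
  induction x using QuotientAddGroup.induction_on with | _ s =>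
  have h := dPhi_coe u.1 u.2.1 (t, s)
  have e : dPhi u.1 (t, (s : AddCircle (4 * Real.pi))) = _ := h.deriv
  exact (h.const_mul (w t : ℂ)).deriv.trans (by rw [← e]; rfl)

lemma mulTest_inv_sin_mulTest_sin (u : testFun) :
    mulTest _ contDiffOn_inv_sin (mulTest _ contDiffOn_sin u) = u := by
  ext p
  change (((Real.sin p.1)⁻¹ : ℝ) : ℂ) * ((Real.sin p.1 : ℂ) * (u : Coord → ℂ) p) = _
  by_cases hp : p.1 ∈ Set.Ioo 0 Real.pi
  · have hs := Real.sin_pos_of_pos_of_lt_pi hp.1 hp.2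
    rw [← mul_assoc, ← Complex.ofReal_mul, inv_mul_cancel₀ hs.ne', Complex.ofReal_one, one_mul]
  · rw [testFun_eq_zero u hp, mul_zero, mul_zero]

/-- The angular component of the gradient. -/
def gradPhi : testFun →ₗ[ℂ] testFun := mulTest _ contDiffOn_inv_sin ∘ₗ dPhiTest

/-- Integration by parts in each variable. In the `θ` term the outer `1 / sin θ` meets the inner
`sin θ`; in the `φ` term one of the two factors `1 / sin θ` moves to `v`. -/
lemma inner_laplaceTest (u v : testFun) :
    ⟪toL2 (laplaceTest u), toL2 v⟫_ℂ =
      ⟪toL2 (dThetaTest u), toL2 (dThetaTest v)⟫_ℂ + ⟪toL2 (gradPhi u), toL2 (gradPhi v)⟫_ℂ := by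
  have e : laplaceTest u = -(mulTest _ contDiffOn_inv_sin (mulTest _ contDiffOn_inv_sin
      (dPhiTest (dPhiTest u)))) - mulTest _ contDiffOn_inv_sin
      (dThetaTest (mulTest _ contDiffOn_sin (dThetaTest u))) := rfl
  rw [e, map_sub, map_neg, inner_sub_left, inner_neg_left, inner_dTheta,
    mulTest_inv_sin_mulTest_sin, inner_mulTest, ← dPhiTest_mulTest, inner_dPhi, dPhiTest_mulTest]
  simp only [neg_neg, sub_neg_eq_add, gradPhi, LinearMap.comp_apply]
  exact add_comm _ _

/-! ### The Friedrichs graph is closed and symmetric -/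

/-- The closure of the graph of the gradient on test functions. -/
def gradClosure : Submodule ℂ (L2 × L2 × L2) := (LinearMap.range gradGraph).topologicalClosure

lemma gradClosure_induction {P : L2 × L2 × L2 → Prop} (hcl : IsClosed {x | P x})
    (h : ∀ v : testFun, P (toL2 v, toL2 (dThetaTest v), toL2 (gradPhi v)))
    {x : L2 × L2 × L2} (hx : x ∈ gradClosure) : P x := by
  refine closure_minimal (s := (LinearMap.range gradGraph : Set (L2 × L2 × L2))) ?_ hcl hx
  rintro _ ⟨v, rfl⟩
  exact h v

/-- Green's formula for elements of the form domain. -/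
lemma grad_inner_grad {x y : L2 × L2 × L2} {f : L2} (hx : x ∈ gradClosure) (hy : y ∈ gradClosure)
    (hf : (y.1, f) ∈ friedrichsGraph) :
    ⟪x.2.1, y.2.1⟫_ℂ + ⟪x.2.2, y.2.2⟫_ℂ = ⟪x.1, f⟫_ℂ := by
  refine gradClosure_induction (P := fun x => ⟪x.2.1, y.2.1⟫_ℂ + ⟪x.2.2, y.2.2⟫_ℂ = ⟪x.1, f⟫_ℂ)
    (isClosed_eq (by fun_prop) (by fun_prop)) (fun v => ?_) hx
  rw [← hf.2 v]
  refine gradClosure_induction (P := fun y => ⟪toL2 (dThetaTest v), y.2.1⟫_ℂ +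
    ⟪toL2 (gradPhi v), y.2.2⟫_ℂ = ⟪toL2 (laplaceTest v), y.1⟫_ℂ)
    (isClosed_eq (by fun_prop) (by fun_prop)) (fun u => ?_) hy
  exact (inner_laplaceTest v u).symm

/-- Both sides equal the form of the two gradients. The adjoint identity alone only tests against
compactly supported functions; the form domain provides the gradients that can be paired with each
other. -/
lemma friedrichsGraph_symm {p q : L2 × L2} (hp : p ∈ friedrichsGraph) (hq : q ∈ friedrichsGraph) :
    ⟪p.1, q.2⟫_ℂ = ⟪p.2, q.1⟫_ℂ := by
  obtain ⟨x, hx, hxp⟩ := hp.1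
  obtain ⟨y, hy, hyq⟩ := hq.1
  change x.1 = p.1 at hxp
  change y.1 = q.1 at hyq
  have h1 := grad_inner_grad hx hy (f := q.2) (by rw [hyq]; exact hq)
  have h2 := grad_inner_grad hy hx (f := p.2) (by rw [hxp]; exact hp)
  rw [← hxp, ← hyq, ← h1, ← inner_conj_symm p.2, ← h2, map_add, inner_conj_symm, inner_conj_symm]

/-- Green's formula on the diagonal with Cauchy–Schwarz: the graph norm controls the gradient. -/
lemma norm_grad_sq {x : L2 × L2 × L2} {f : L2} (hx : x ∈ gradClosure)
    (hf : (x.1, f) ∈ friedrichsGraph) : ‖x.2.1‖ ^ 2 + ‖x.2.2‖ ^ 2 ≤ ‖x.1‖ * ‖f‖ := by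
  have h := grad_inner_grad hx hx hf
  rw [inner_self_eq_norm_sq_to_K, inner_self_eq_norm_sq_to_K] at h
  refine le_trans (le_of_eq ?_) (norm_inner_le_norm (𝕜 := ℂ) x.1 f)
  rw [← h]
  have : ((‖x.2.1‖ : ℂ) ^ 2 + (‖x.2.2‖ : ℂ) ^ 2) = ((‖x.2.1‖ ^ 2 + ‖x.2.2‖ ^ 2 : ℝ) : ℂ) := by
    push_cast; rfl
  change _ = ‖((‖x.2.1‖ : ℂ) ^ 2 + (‖x.2.2‖ : ℂ) ^ 2)‖
  rw [this, Complex.norm_real, Real.norm_of_nonneg (by positivity)]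

/-- The adjoint identity passes to limits at once; membership in the form domain does not, since
convergence in `L²` says nothing about gradients. The energy bound applied to differences makes the
gradients Cauchy as well, and the limiting triple lies in `gradClosure`. -/
lemma isClosed_friedrichsGraph : IsClosed (friedrichsGraph : Set (L2 × L2)) := by
  refine IsSeqClosed.isClosed fun p q hp hpq => ?_
  have h1 := (continuous_fst.tendsto q).comp hpq
  have h2 := (continuous_snd.tendsto q).comp hpq
  refine ⟨?_, fun v => tendsto_nhds_unique ((Filter.Tendsto.inner tendsto_const_nhds h1).congr
    fun n => (hp n).2 v) (Filter.Tendsto.inner tendsto_const_nhds h2)⟩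
  have hex (n : ℕ) : ∃ x ∈ gradClosure, x.1 = (p n).1 := (hp n).1
  choose x hx hxp using hex
  have hcauchy : CauchySeq x := by
    have hpc := hpq.cauchySeq
    rw [Metric.cauchySeq_iff] at hpc ⊢
    intro ε hε
    obtain ⟨N, hN⟩ := hpc ε hε
    refine ⟨N, fun m hm n hn => ?_⟩
    have hd := hN m hm n hn
    rw [dist_eq_norm, Prod.norm_def, max_lt_iff] at hd
    have hb := norm_grad_sq (f := (p m - p n).2) (gradClosure.sub_mem (hx m) (hx n)) (by
      have : ((x m - x n).1, (p m - p n).2) = p m - p n := by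
        rw [Prod.fst_sub, hxp, hxp]; rfl
      rw [this]
      exact friedrichsGraph.sub_mem (hp m) (hp n))
    have e1 : (x m - x n).1 = (p m - p n).1 := by rw [Prod.fst_sub, hxp, hxp]; rfl
    have hprod : ‖(x m - x n).1‖ * ‖(p m - p n).2‖ < ε * ε := by
      rw [e1]
      exact mul_lt_mul'' hd.1 hd.2 (norm_nonneg _) (norm_nonneg _)
    rw [dist_eq_norm, Prod.norm_def, Prod.norm_def, max_lt_iff, max_lt_iff]
    refine ⟨e1 ▸ hd.1, ?_, ?_⟩
    · nlinarith [norm_nonneg (x m - x n).2.1, sq_nonneg ‖(x m - x n).2.2‖]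
    · nlinarith [norm_nonneg (x m - x n).2.2, sq_nonneg ‖(x m - x n).2.1‖]
  obtain ⟨y, hy⟩ := cauchySeq_tendsto_of_complete hcauchy
  refine ⟨y, (Submodule.isClosed_topologicalClosure _).mem_of_tendsto hy
    (Filter.Eventually.of_forall hx), ?_⟩
  refine tendsto_nhds_unique ((continuous_fst.tendsto y).comp hy) (h1.congr fun n => ?_)
  exact (hxp n).symm

/-! ### Square integrable functions of the colatitude -/

/-- Dominated convergence in `L²`: the differences are bounded by `2 B`, whose square is integrable.
-/
lemma tendsto_toLp_of_dominated {f : ℕ → Coord → ℂ} {g : Coord → ℂ} {B : Coord → ℝ}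
    (hf : ∀ n, MemLp (f n) 2 area) (hg : MemLp g 2 area) (hB : MemLp B 2 area)
    (hbd : ∀ n, ∀ᵐ p ∂area, ‖f n p‖ ≤ B p)
    (hlim : ∀ᵐ p ∂area, Filter.Tendsto (fun n => f n p) Filter.atTop (nhds (g p))) :
    Filter.Tendsto (fun n => (hf n).toLp) Filter.atTop (nhds hg.toLp) := by
  rw [Lp.tendsto_Lp_iff_tendsto_eLpNorm'' _ hf _ hg]
  have hg' : ∀ᵐ p ∂area, ‖g p‖ ≤ B p := by
    filter_upwards [ae_all_iff.2 hbd, hlim] with p h1 h2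
    exact le_of_tendsto h2.norm (Filter.Eventually.of_forall h1)
  have hfin : ∫⁻ p, ‖2 * B p‖ₑ ^ (2 : ℝ) ∂area ≠ ⊤ := by
    have h := (hB.const_mul 2).eLpNorm_lt_top
    rw [eLpNorm_lt_top_iff_lintegral_rpow_enorm_lt_top (by simp) (by simp)] at h
    simpa using h.ne
  have key := tendsto_lintegral_of_dominated_convergence' (μ := area)
    (F := fun n p => ‖(f n - g) p‖ₑ ^ (2 : ℝ)) (f := fun _ => 0) (fun p => ‖2 * B p‖ₑ ^ (2 : ℝ))
    (fun n => (((hf n).sub hg).1.enorm).pow_const _) (fun n => ?_) hfin ?_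
  · simp only [lintegral_zero] at key
    have h2 := (ENNReal.continuous_rpow_const (y := 1 / 2)).tendsto 0 |>.comp key
    rw [ENNReal.zero_rpow_of_pos (by norm_num)] at h2
    refine h2.congr fun n => ?_
    rw [eLpNorm_eq_lintegral_rpow_enorm_toReal (by simp) (by simp)]
    simp
  · filter_upwards [hbd n, hg'] with p h1 h2
    refine ENNReal.rpow_le_rpow ?_ (by norm_num)
    rw [enorm_le_iff_norm_le, Pi.sub_apply]
    refine (norm_sub_le _ _).trans ?_
    rw [Real.norm_eq_abs]
    refine le_trans ?_ (le_abs_self _)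
    linarith
  · filter_upwards [hlim] with p hp
    have h1 : Filter.Tendsto (fun n => ‖(f n - g) p‖ₑ) Filter.atTop (nhds 0) := by
      have h0 : Filter.Tendsto (fun n => f n p - g p) Filter.atTop (nhds 0) := by
        simpa using hp.sub_const (g p)
      have h2 := h0.enorm
      rw [enorm_zero] at h2
      exact h2
    have h2 := (ENNReal.continuous_rpow_const (y := 2)).tendsto 0 |>.comp h1
    rwa [ENNReal.zero_rpow_of_pos (by norm_num)] at h2

lemma memLp_colatitude {B : ℝ → ℝ} (hm : Measurable B)
    (hi : IntegrableOn (fun θ => B θ ^ 2 * Real.sin θ) (Set.Ioo 0 Real.pi)) :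
    MemLp (fun p : Coord => B p.1) 2 area := by
  refine (memLp_two_iff_integrable_sq (hm.comp measurable_fst).aestronglyMeasurable).2 ?_
  refine Integrable.comp_fst (f := fun θ => B θ ^ 2) ?_ _
  rw [integrable_withDensity_iff (by fun_prop) (by simp)]
  refine hi.congr_fun (fun θ hθ => ?_) measurableSet_Ioo
  simp only
  rw [ENNReal.toReal_ofReal (Real.sin_pos_of_pos_of_lt_pi hθ.1 hθ.2).le]

/-- The square `1 / sin θ` exactly cancels the density. This is the growth of the gradient at the
poles when `|m| = 1/2`. -/
lemma memLp_rpow_sin : MemLp (fun p : Coord => Real.sin p.1 ^ (-(1 / 2) : ℝ)) 2 area := by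
  refine memLp_colatitude (B := fun θ => Real.sin θ ^ (-(1 / 2) : ℝ)) (by fun_prop) ?_
  have : IntegrableOn (fun _ : ℝ => (1 : ℝ)) (Set.Ioo 0 Real.pi) := by simp
  refine this.congr_fun (fun θ hθ => ?_) measurableSet_Ioo
  have hs := Real.sin_pos_of_pos_of_lt_pi hθ.1 hθ.2
  simp only
  rw [← Real.rpow_natCast, ← Real.rpow_mul hs.le]
  norm_num
  rw [Real.rpow_neg_one, inv_mul_cancel₀ hs.ne']

/-- The function `1 / (1 - log s)`, continued by `0` to `s = 0`. -/
def logRecip : ℝ → ℝ := Function.update (fun s => (1 - Real.log s)⁻¹) 0 0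

lemma continuousOn_logRecip : ContinuousOn logRecip (Set.Icc 0 1) := by
  intro s hs
  rcases eq_or_lt_of_le hs.1 with rfl | h0
  · refine ContinuousAt.continuousWithinAt (continuousAt_update_same.2 ?_)
    refine Filter.Tendsto.inv_tendsto_atTop ?_
    exact Filter.tendsto_atTop_add_const_left _ 1
      (Filter.tendsto_neg_atBot_atTop.comp Real.tendsto_log_nhdsNE_zero)
  · refine ContinuousAt.continuousWithinAt ?_
    refine (continuousAt_update_of_ne h0.ne').2 ?_
    have h1 := Real.log_nonpos hs.1 hs.2
    have h2 : 1 - Real.log s ≠ 0 := by linarith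
    exact (continuousAt_const.sub (Real.continuousAt_log h0.ne')).inv₀ h2

lemma hasDerivAt_logRecip_sin {θ : ℝ} (hθ : θ ∈ Set.Ioo 0 Real.pi) :
    HasDerivAt (fun t => logRecip (Real.sin t))
      (Real.cos θ / (Real.sin θ * (1 - Real.log (Real.sin θ)) ^ 2)) θ := by
  have hs := Real.sin_pos_of_pos_of_lt_pi hθ.1 hθ.2
  have hl := Real.log_nonpos hs.le (Real.sin_le_one θ)
  have h := (((Real.hasDerivAt_sin θ).log hs.ne').const_sub 1).inv (by linarith)
  have hev : (fun t => logRecip (Real.sin t)) =ᶠ[nhds θ]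
      (fun t => (1 - Real.log (Real.sin t)))⁻¹ := by
    filter_upwards [isOpen_Ioo.mem_nhds hθ] with t ht
    exact Function.update_of_ne (Real.sin_pos_of_pos_of_lt_pi ht.1 ht.2).ne' _ _
  refine (h.congr_of_eventuallyEq hev).congr_deriv ?_
  have : (1 - Real.log (Real.sin θ)) ≠ 0 := by linarith
  field_simp

/-- Up to sign the integrand is the derivative of `logRecip (sin θ)`, which is continuous up to the
poles and monotone on each half of the interval; such a derivative is integrable. The sign changes
at `π / 2` with that of `cos θ`. -/
lemma integrableOn_log_weight : IntegrableOn
    (fun θ => |Real.cos θ| / (Real.sin θ * (1 - Real.log (Real.sin θ)) ^ 2))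
    (Set.Ioo 0 Real.pi) := by
  have hpi := Real.pi_pos
  have hnn (θ : ℝ) (hθ : θ ∈ Set.Ioo 0 Real.pi) :
      0 ≤ Real.sin θ * (1 - Real.log (Real.sin θ)) ^ 2 :=
    mul_nonneg (Real.sin_pos_of_pos_of_lt_pi hθ.1 hθ.2).le (sq_nonneg _)
  have hcont : ContinuousOn (fun t => logRecip (Real.sin t)) (Set.Icc 0 Real.pi) :=
    continuousOn_logRecip.comp Real.continuous_sin.continuousOn
      fun t ht => ⟨Real.sin_nonneg_of_mem_Icc ht, Real.sin_le_one t⟩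
  have h1 := intervalIntegral.integrableOn_deriv_of_nonneg (a := 0) (b := Real.pi / 2)
    (hcont.mono (Set.Icc_subset_Icc le_rfl (by linarith)))
    (fun θ hθ => hasDerivAt_logRecip_sin ⟨hθ.1, by linarith [hθ.2]⟩) (fun θ hθ => div_nonneg
      (Real.cos_nonneg_of_mem_Icc ⟨by linarith [hθ.1], hθ.2.le⟩)
      (hnn θ ⟨hθ.1, by linarith [hθ.2]⟩))
  have h2 := intervalIntegral.integrableOn_deriv_of_nonneg (a := Real.pi / 2) (b := Real.pi)
    (hcont.neg.mono (Set.Icc_subset_Icc (by linarith) le_rfl))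
    (fun θ hθ => (hasDerivAt_logRecip_sin ⟨by linarith [hθ.1], hθ.2⟩).neg) (fun θ hθ => by
      rw [← neg_div]
      exact div_nonneg (neg_nonneg.2 (Real.cos_nonpos_of_pi_div_two_le_of_le hθ.1.le
        (by linarith [hθ.2]))) (hnn θ ⟨by linarith [hθ.1], hθ.2⟩))
  have h2' := h2.norm
  simp only [norm_neg] at h2'
  have hmain := (IntegrableOn.union h1.norm h2').mono_set (s := Set.Ioo 0 Real.pi) (fun t ht => by
    rcases le_or_gt t (Real.pi / 2) with h | h
    · exact Or.inl ⟨ht.1, h⟩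
    · exact Or.inr ⟨h, ht.2.le⟩)
  refine hmain.congr_fun (fun θ hθ => ?_) measurableSet_Ioo
  simp only [norm_div, Real.norm_eq_abs, abs_of_nonneg (hnn θ hθ)]

lemma memLp_log_weight : MemLp (fun p : Coord =>
    |Real.cos p.1| / (Real.sin p.1 * (1 - Real.log (Real.sin p.1)))) 2 area := by
  refine memLp_colatitude
    (B := fun θ => |Real.cos θ| / (Real.sin θ * (1 - Real.log (Real.sin θ)))) (by fun_prop) ?_
  refine Integrable.mono' integrableOn_log_weight (by fun_prop) ?_
  filter_upwards [ae_restrict_mem measurableSet_Ioo] with θ hθ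
  have hs := Real.sin_pos_of_pos_of_lt_pi hθ.1 hθ.2
  have hl := Real.log_nonpos hs.le (Real.sin_le_one θ)
  have hT : 0 < 1 - Real.log (Real.sin θ) := by linarith
  rw [Real.norm_of_nonneg (by positivity)]
  have e : (|Real.cos θ| / (Real.sin θ * (1 - Real.log (Real.sin θ)))) ^ 2 * Real.sin θ =
      |Real.cos θ| * (|Real.cos θ| / (Real.sin θ * (1 - Real.log (Real.sin θ)) ^ 2)) := by
    field_simp
  rw [e]
  exact mul_le_of_le_one_left (by positivity) (Real.abs_cos_le_one θ)

/-! ### Functions with separated variables -/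

/-- The function `exp (i k φ / 2) f(θ)`. -/
def tensor (k : ℤ) (f : ℝ → ℝ) (p : Coord) : ℂ := fourier (T := 4 * Real.pi) k p.2 * (f p.1 : ℂ)

lemma norm_tensor (k : ℤ) (f : ℝ → ℝ) (p : Coord) : ‖tensor k f p‖ = |f p.1| := by
  rw [tensor, norm_mul, fourier_apply, Circle.norm_coe, one_mul, Complex.norm_real,
    Real.norm_eq_abs]

lemma fourier_four_pi (k : ℤ) (a : ℝ) :
    fourier (T := 4 * Real.pi) k (a : AddCircle (4 * Real.pi)) =
      Complex.exp ((k / 2 * Complex.I) * a) := by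
  rw [fourier_coe_apply]
  congr 1
  have : (Real.pi : ℂ) ≠ 0 := by exact_mod_cast Real.pi_ne_zero
  push_cast
  field_simp
  ring

lemma fourier_add_arg (k : ℤ) (x y : AddCircle (4 * Real.pi)) :
    fourier k (x + y) = fourier k x * fourier k y := by
  rw [fourier_apply, fourier_apply, fourier_apply, smul_add, AddCircle.toCircle_add, Circle.coe_mul]

lemma dTheta_tensor (k : ℤ) {f : ℝ → ℝ} {p : Coord} (hf : DifferentiableAt ℝ f p.1) :
    dTheta (tensor k f) p = tensor k (deriv f) p :=
  (hf.hasDerivAt.ofReal_comp.const_mul (fourier (T := 4 * Real.pi) k p.2)).deriv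

lemma dPhi_tensor (k : ℤ) (f : ℝ → ℝ) (p : Coord) :
    dPhi (tensor k f) p = (k / 2 * Complex.I) * tensor k f p := by
  have h : HasDerivAt (fun s : ℝ => Complex.exp ((k / 2 * Complex.I) * s))
      (k / 2 * Complex.I) 0 := by
    have := ((Complex.ofRealCLM.hasDerivAt (x := (0 : ℝ))).const_mul
      ((k : ℂ) / 2 * Complex.I)).cexp
    simpa using this
  have h2 := (h.const_mul (tensor k f p)).deriv
  rw [mul_comm, ← h2, dPhi]
  congr 1
  ext s
  rw [tensor, tensor, fourier_add_arg, fourier_four_pi]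
  ring

lemma dPhi_dPhi_tensor (k : ℤ) (f : ℝ → ℝ) (p : Coord) :
    dPhi (dPhi (tensor k f)) p = -((k / 2 : ℝ) ^ 2 : ℝ) * tensor k f p := by
  have h : dPhi (tensor k f) = fun p => (k / 2 * Complex.I) * tensor k f p :=
    funext fun p => dPhi_tensor k f p
  have h2 : dPhi (fun p => (k / 2 * Complex.I) * tensor k f p) p =
      (k / 2 * Complex.I) * dPhi (tensor k f) p := deriv_const_mul_field _
  rw [h, h2, dPhi_tensor]
  push_cast
  linear_combination (k / 2 : ℂ) ^ 2 * tensor k f p * Complex.I_sq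

/-- A smooth function supported in a compact subset of `(0, π)` is a test function of the
colatitude. -/
lemma tensor_mem_testFun (k : ℤ) {f : ℝ → ℝ} {K : Set ℝ} (hK : IsCompact K)
    (hsub : K ⊆ Set.Ioo 0 Real.pi) (h0 : ∀ θ ∉ K, f θ = 0)
    (hc : ContDiffOn ℝ ∞ f (Set.Ioo 0 Real.pi)) : tensor k f ∈ testFun := by
  have hcf : ContDiff ℝ ∞ f := by
    rw [contDiff_iff_contDiffAt]
    intro θ
    by_cases hθ : θ ∈ Set.Ioo 0 Real.pi
    · exact hc.contDiffAt (isOpen_Ioo.mem_nhds hθ)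
    · refine (contDiffAt_const (c := (0 : ℝ))).congr_of_eventuallyEq ?_
      filter_upwards [hK.isClosed.isOpen_compl.mem_nhds fun h => hθ (hsub h)] with t ht
      exact h0 t ht
  have hsupp : Function.support (tensor k f) ⊆ K ×ˢ Set.univ := by
    intro p hp
    refine ⟨?_, trivial⟩
    by_contra h
    exact hp (by rw [tensor, h0 _ h, Complex.ofReal_zero, mul_zero])
  have hKu : IsCompact (K ×ˢ (Set.univ : Set (AddCircle (4 * Real.pi)))) :=
    hK.prod isCompact_univ
  refine ⟨?_, HasCompactSupport.of_support_subset_isCompact hKu hsupp,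
    (closure_minimal hsupp hKu.isClosed).trans (Set.prod_mono hsub le_rfl)⟩
  have e : lift (tensor k f) = fun q : ℝ × ℝ =>
      Complex.exp ((k / 2 * Complex.I) * (q.2 : ℂ)) * (f q.1 : ℂ) := by
    ext q
    rw [lift, tensor, fourier_four_pi]
  rw [e]
  have hof : ContDiff ℝ ∞ (fun x : ℝ => (x : ℂ)) := Complex.ofRealCLM.contDiff
  exact ((contDiff_const.mul (hof.comp contDiff_snd)).cexp).mul
    (hof.comp (hcf.comp contDiff_fst))

lemma measurable_tensor (k : ℤ) {f : ℝ → ℝ} (hf : Measurable f) : Measurable (tensor k f) :=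
  ((map_continuous _).measurable.comp measurable_snd).mul
    (Complex.measurable_ofReal.comp (hf.comp measurable_fst))

lemma memLp_tensor (k : ℤ) {f : ℝ → ℝ} {B : Coord → ℝ} (hm : Measurable f) (hB : MemLp B 2 area)
    (hb : ∀ p : Coord, p.1 ∈ Set.Ioo 0 Real.pi → |f p.1| ≤ B p) : MemLp (tensor k f) 2 area := by
  refine hB.mono (measurable_tensor k hm).aestronglyMeasurable ?_
  filter_upwards [ae_area] with p hp
  rw [norm_tensor]
  exact (hb p hp).trans (le_abs_self _)

/-! ### Logarithmic cutoff functions -/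

/-- A smooth cutoff function which vanishes where `log (sin θ) ≤ -2N - 1` and equals `1` where
`log (sin θ) ≥ -N`. -/
def cutoff (N : ℕ) (θ : ℝ) : ℝ :=
  Real.smoothTransition (2 - (1 - Real.log (Real.sin θ)) / (N + 1))

lemma one_le_one_sub_log_sin {θ : ℝ} (hθ : θ ∈ Set.Ioo 0 Real.pi) :
    1 ≤ 1 - Real.log (Real.sin θ) := by
  have hs := Real.sin_pos_of_pos_of_lt_pi hθ.1 hθ.2
  have hl := Real.log_nonpos hs.le (Real.sin_le_one θ)
  linarith

lemma abs_cutoff_le (N : ℕ) (θ : ℝ) : |cutoff N θ| ≤ 1 :=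
  abs_le.2 ⟨by linarith [Real.smoothTransition.nonneg (2 - (1 - Real.log (Real.sin θ)) / (N + 1)),
    cutoff.eq_def N θ], Real.smoothTransition.le_one _⟩

lemma cutoff_eq_one {N : ℕ} {θ : ℝ} (h : 1 - Real.log (Real.sin θ) ≤ N + 1) : cutoff N θ = 1 := by
  apply Real.smoothTransition.one_of_one_le
  have : (1 - Real.log (Real.sin θ)) / (N + 1) ≤ 1 := (div_le_one (by positivity)).2 h
  linarith

lemma cutoff_eq_zero {N : ℕ} {θ : ℝ} (h : 2 * (N + 1) ≤ 1 - Real.log (Real.sin θ)) :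
    cutoff N θ = 0 := by
  apply Real.smoothTransition.zero_of_nonpos
  have : 2 ≤ (1 - Real.log (Real.sin θ)) / (N + 1) := (le_div_iff₀ (by positivity)).2 h
  linarith

lemma hasDerivAt_cutoff (N : ℕ) {θ : ℝ} (hθ : θ ∈ Set.Ioo 0 Real.pi) :
    HasDerivAt (cutoff N) (deriv Real.smoothTransition
      (2 - (1 - Real.log (Real.sin θ)) / (N + 1)) *
        (Real.cos θ / Real.sin θ / (N + 1))) θ := by
  have hs := Real.sin_pos_of_pos_of_lt_pi hθ.1 hθ.2
  have h1 := ((((Real.hasDerivAt_sin θ).log hs.ne').const_sub 1).div_const ((N : ℝ) + 1)).const_sub 2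
  have h2 : HasDerivAt Real.smoothTransition _ (2 - (1 - Real.log (Real.sin θ)) / (N + 1)) :=
    ((Real.smoothTransition.contDiff (n := 1)).differentiable (by simp)).differentiableAt.hasDerivAt
  refine (h2.comp θ h1).congr_deriv ?_
  ring

lemma contDiffOn_cutoff (N : ℕ) : ContDiffOn ℝ ∞ (cutoff N) (Set.Ioo 0 Real.pi) := by
  refine Real.smoothTransition.contDiff.comp_contDiffOn ?_
  exact contDiffOn_const.sub ((contDiffOn_const.sub (contDiffOn_sin.log
    fun θ hθ => (Real.sin_pos_of_pos_of_lt_pi hθ.1 hθ.2).ne')).div_const _)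

/-- The derivative is continuous and vanishes off `[0, 1]`. -/
lemma exists_bound_deriv_smoothTransition :
    ∃ C, 0 ≤ C ∧ ∀ x, |deriv Real.smoothTransition x| ≤ C := by
  have hc : Continuous (deriv Real.smoothTransition) :=
    (Real.smoothTransition.contDiff (n := 1)).continuous_deriv (by simp)
  obtain ⟨C, hC⟩ := isCompact_Icc.exists_bound_of_continuousOn (s := Set.Icc (0 : ℝ) 1)
    hc.continuousOn
  have h0 := hC 0 (by simp)
  refine ⟨C, (norm_nonneg _).trans h0, fun x => ?_⟩
  by_cases hx : x ∈ Set.Icc (0 : ℝ) 1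
  · exact hC x hx
  · have : deriv Real.smoothTransition x = 0 := by
      rw [Set.mem_Icc, not_and_or, not_le, not_le] at hx
      rcases hx with hx | hx
      · have : Real.smoothTransition =ᶠ[nhds x] fun _ => 0 := by
          filter_upwards [isOpen_Iio.mem_nhds hx] with y hy
          exact Real.smoothTransition.zero_of_nonpos (le_of_lt hy)
        rw [this.deriv_eq, deriv_const]
      · have : Real.smoothTransition =ᶠ[nhds x] fun _ => 1 := by
          filter_upwards [isOpen_Ioi.mem_nhds hx] with y hy
          exact Real.smoothTransition.one_of_one_le (le_of_lt hy)
        rw [this.deriv_eq, deriv_const]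
    rw [this, abs_zero]
    exact (norm_nonneg _).trans h0

/-- Where the cutoff varies, `1 - log (sin θ) ≤ 2 (N + 1)`, so the factor `1 / (N + 1)` from the
chain rule can be traded for `2 / (1 - log (sin θ))`. The resulting bound is independent of `N` and
square integrable by `memLp_log_weight`; the extra logarithm is what the cutoffs are designed to
gain. -/
lemma exists_bound_deriv_cutoff : ∃ C, 0 ≤ C ∧ ∀ N : ℕ, ∀ θ ∈ Set.Ioo 0 Real.pi,
    |deriv (cutoff N) θ| ≤
      C * (|Real.cos θ| / (Real.sin θ * (1 - Real.log (Real.sin θ)))) := by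
  obtain ⟨C, hC0, hC⟩ := exists_bound_deriv_smoothTransition
  refine ⟨2 * C, by positivity, fun N θ hθ => ?_⟩
  have hs := Real.sin_pos_of_pos_of_lt_pi hθ.1 hθ.2
  have hT := one_le_one_sub_log_sin hθ
  have hd := (hasDerivAt_cutoff N hθ).deriv
  set T := 1 - Real.log (Real.sin θ) with hTdef
  have hT0 : 0 < T := by linarith
  have hN : (0 : ℝ) < N + 1 := by positivity
  by_cases h : T ≤ 2 * (N + 1)
  · rw [hd, abs_mul, abs_div, abs_div, abs_of_pos hs, abs_of_pos hN]
    have h1 : 1 / ((N : ℝ) + 1) ≤ 2 / T := by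
      rw [div_le_div_iff₀ hN hT0]; linarith
    calc |deriv Real.smoothTransition (2 - T / (N + 1))| * (|Real.cos θ| / Real.sin θ / (N + 1))
        ≤ C * (|Real.cos θ| / Real.sin θ / (N + 1)) := by gcongr; exact hC _
      _ = C * (|Real.cos θ| / Real.sin θ) * (1 / (N + 1)) := by ring
      _ ≤ C * (|Real.cos θ| / Real.sin θ) * (2 / T) := by gcongr
      _ = 2 * C * (|Real.cos θ| / (Real.sin θ * T)) := by field_simp
  · have hx : 2 - T / (N + 1) < 0 := by
      have : 2 < T / (N + 1) := (lt_div_iff₀ hN).2 (not_le.1 h)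
      linarith
    have hz : deriv Real.smoothTransition (2 - T / (N + 1)) = 0 := by
      have : Real.smoothTransition =ᶠ[nhds (2 - T / (N + 1))] fun _ => 0 := by
        filter_upwards [isOpen_Iio.mem_nhds hx] with y hy
        exact Real.smoothTransition.zero_of_nonpos (le_of_lt hy)
      rw [this.deriv_eq, deriv_const]
    rw [hd, hz, zero_mul, abs_zero]
    positivity

/-- Near a point of `(0, π)` the cutoff functions are eventually equal to `1`. -/
lemma cutoff_eventuallyEq_one {N : ℕ} {θ : ℝ} (hθ : θ ∈ Set.Ioo 0 Real.pi)
    (h : 1 - Real.log (Real.sin θ) < N + 1) : cutoff N =ᶠ[nhds θ] fun _ => 1 := by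
  have hc : ContinuousAt (fun t => 1 - Real.log (Real.sin t)) θ :=
    continuousAt_const.sub (Real.continuous_sin.continuousAt.log
      (Real.sin_pos_of_pos_of_lt_pi hθ.1 hθ.2).ne')
  filter_upwards [hc.eventually (gt_mem_nhds h)] with t ht
  exact cutoff_eq_one (le_of_lt ht)

/-- The cut-off of a function of the colatitude, continued by zero outside of `(0, π)`. -/
def cut (g : ℝ → ℝ) (N : ℕ) : ℝ → ℝ :=
  (Set.Ioo 0 Real.pi).indicator fun θ => cutoff N θ * g θ

lemma cut_mem_testFun (k : ℤ) {g : ℝ → ℝ} (hg : ContDiffOn ℝ ∞ g (Set.Ioo 0 Real.pi)) (N : ℕ) :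
    tensor k (cut g N) ∈ testFun := by
  have hpi := Real.pi_pos
  -- The cutoff vanishes once `log (sin θ) ≤ 1 - 2 (N + 1)`, in particular below the chosen
  -- threshold; the set is compact and misses the poles, where `sin` is zero.
  refine tensor_mem_testFun k (K := Set.Icc 0 Real.pi ∩
    {θ | Real.exp (-(2 * (N + 1))) ≤ Real.sin θ}) (isCompact_Icc.inter_right
      (isClosed_le continuous_const Real.continuous_sin)) ?_ ?_ ?_
  · rintro θ ⟨h1, h2⟩
    have hs : 0 < Real.sin θ := (Real.exp_pos _).trans_le h2
    refine ⟨lt_of_le_of_ne h1.1 ?_, lt_of_le_of_ne h1.2 ?_⟩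
    · rintro rfl; simp at hs
    · rintro rfl; simp at hs
  · intro θ hθ
    by_cases h : θ ∈ Set.Ioo 0 Real.pi
    · have hs := Real.sin_pos_of_pos_of_lt_pi h.1 h.2
      have h2 : Real.sin θ < Real.exp (-(2 * (N + 1))) := by
        by_contra h3
        exact hθ ⟨Set.Ioo_subset_Icc_self h, not_lt.1 h3⟩
      rw [cut, Set.indicator_of_mem h, cutoff_eq_zero, zero_mul]
      have := (Real.log_lt_iff_lt_exp hs).2 h2
      linarith
    · rw [cut, Set.indicator_of_notMem h]
  · exact ((contDiffOn_cutoff N).mul hg).congr fun θ hθ => Set.indicator_of_mem hθ _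

lemma cut_eventuallyEq {g : ℝ → ℝ} {N : ℕ} {θ : ℝ} (hθ : θ ∈ Set.Ioo 0 Real.pi) :
    cut g N =ᶠ[nhds θ] fun t => cutoff N t * g t := by
  filter_upwards [isOpen_Ioo.mem_nhds hθ] with t ht
  exact Set.indicator_of_mem ht _

lemma cut_eventuallyEq_self {g : ℝ → ℝ} {N : ℕ} {θ : ℝ} (hθ : θ ∈ Set.Ioo 0 Real.pi)
    (h : 1 - Real.log (Real.sin θ) < N + 1) : cut g N =ᶠ[nhds θ] g := by
  filter_upwards [cut_eventuallyEq hθ, cutoff_eventuallyEq_one hθ h] with t h1 h2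
  rw [h1, h2, one_mul]

lemma deriv_cut {g : ℝ → ℝ} (hg : ContDiffOn ℝ ∞ g (Set.Ioo 0 Real.pi)) {N : ℕ} {θ : ℝ}
    (hθ : θ ∈ Set.Ioo 0 Real.pi) :
    deriv (cut g N) θ = deriv (cutoff N) θ * g θ + cutoff N θ * deriv g θ := by
  rw [(cut_eventuallyEq hθ).deriv_eq]
  exact deriv_fun_mul (hasDerivAt_cutoff N hθ).differentiableAt
    ((hg.contDiffAt (isOpen_Ioo.mem_nhds hθ)).differentiableAt (by simp))

/-! ### A criterion for eigenfunctions with separated variables -/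

lemma eventually_one_sub_log_sin_lt (θ : ℝ) : ∀ᶠ N : ℕ in Filter.atTop,
    1 - Real.log (Real.sin θ) < N + 1 := by
  filter_upwards [tendsto_natCast_atTop_atTop.eventually_gt_atTop (1 - Real.log (Real.sin θ))]
    with N hN
  linarith

/-- A function of the colatitude with the bounds at the poles which put `exp (i k φ / 2) g(θ)`
into the form domain. -/
structure IsAdmissible (k : ℤ) (g : ℝ → ℝ) (C : ℝ) : Prop where
  measurable : Measurable g
  contDiffOn : ContDiffOn ℝ ∞ g (Set.Ioo 0 Real.pi)
  bound : ∀ θ ∈ Set.Ioo 0 Real.pi, |g θ| ≤ C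
  bound_deriv : ∀ θ ∈ Set.Ioo 0 Real.pi, |deriv g θ| ≤ C * Real.sin θ ^ (-(1 / 2) : ℝ)
  bound_div : ∀ θ ∈ Set.Ioo 0 Real.pi,
    |(k : ℝ) / 2 * g θ / Real.sin θ| ≤ C * Real.sin θ ^ (-(1 / 2) : ℝ)

namespace IsAdmissible

variable {k : ℤ} {g : ℝ → ℝ} {C : ℝ} (h : IsAdmissible k g C)
include h

lemma memLp : MemLp (tensor k g) 2 area :=
  memLp_tensor k h.measurable (memLp_const C) fun p hp => h.bound p.1 hp

lemma memLp_deriv : MemLp (tensor k (deriv g)) 2 area :=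
  memLp_tensor k (measurable_deriv g) (memLp_rpow_sin.const_mul C) fun p hp => h.bound_deriv p.1 hp

lemma memLp_div :
    MemLp (fun p => Complex.I * tensor k (fun θ => (k : ℝ) / 2 * g θ / Real.sin θ) p) 2 area :=
  (memLp_tensor k ((h.measurable.const_mul _).div Real.measurable_sin)
    (memLp_rpow_sin.const_mul C) fun p hp => h.bound_div p.1 hp).const_mul Complex.I

/-- The cut-off functions, as test functions. -/
def cutTest (N : ℕ) : testFun := ⟨tensor k (cut g N), cut_mem_testFun k h.contDiffOn N⟩

lemma tendsto_cutTest :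
    Filter.Tendsto (fun N => toL2 (h.cutTest N)) Filter.atTop (nhds h.memLp.toLp) := by
  refine tendsto_toLp_of_dominated (fun N => memLp_testFun (h.cutTest N)) h.memLp (memLp_const C)
    (fun N => ?_) ?_
  · filter_upwards [ae_area] with p hp
    change ‖tensor k (cut g N) p‖ ≤ C
    rw [norm_tensor, (cut_eventuallyEq hp).self_of_nhds, abs_mul]
    exact (mul_le_of_le_one_left (abs_nonneg _) (abs_cutoff_le _ _)).trans (h.bound _ hp)
  · filter_upwards [ae_area] with p hp
    refine tendsto_const_nhds.congr' ?_
    filter_upwards [eventually_one_sub_log_sin_lt p.1] with N hN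
    change tensor k g p = tensor k (cut g N) p
    rw [tensor, tensor, (cut_eventuallyEq_self hp hN).self_of_nhds]

lemma differentiableAt_cut (N : ℕ) {θ : ℝ} (hθ : θ ∈ Set.Ioo 0 Real.pi) :
    DifferentiableAt ℝ (cut g N) θ :=
  ((hasDerivAt_cutoff N hθ).differentiableAt.mul ((h.contDiffOn.contDiffAt
    (isOpen_Ioo.mem_nhds hθ)).differentiableAt (by simp))).congr_of_eventuallyEq
      (cut_eventuallyEq hθ)

/-- By the product rule the derivative has two terms: the one with the derivative of the cutoff is
dominated by the logarithmic weight, the other by `(sin θ)^(-1/2)`. Near each fixed `θ` the cutoff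
is eventually identically `1`. -/
lemma tendsto_dTheta_cutTest :
    Filter.Tendsto (fun N => toL2 (dThetaTest (h.cutTest N))) Filter.atTop
      (nhds h.memLp_deriv.toLp) := by
  obtain ⟨D, hD0, hD⟩ := exists_bound_deriv_cutoff
  refine tendsto_toLp_of_dominated (fun N => memLp_testFun (dThetaTest (h.cutTest N)))
    h.memLp_deriv (((memLp_log_weight.const_mul D).mul_const C).add (memLp_rpow_sin.const_mul C))
    (fun N => ?_) ?_
  · filter_upwards [ae_area] with p hp
    change ‖dTheta (tensor k (cut g N)) p‖ ≤ _
    rw [dTheta_tensor k (h.differentiableAt_cut N hp), norm_tensor, deriv_cut h.contDiffOn hp]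
    refine (abs_add_le _ _).trans (add_le_add ?_ ?_)
    · rw [abs_mul]
      exact mul_le_mul (hD N _ hp) (h.bound _ hp) (abs_nonneg _)
        ((abs_nonneg _).trans (hD N _ hp))
    · rw [abs_mul]
      exact (mul_le_of_le_one_left (abs_nonneg _) (abs_cutoff_le _ _)).trans (h.bound_deriv _ hp)
  · filter_upwards [ae_area] with p hp
    refine tendsto_const_nhds.congr' ?_
    filter_upwards [eventually_one_sub_log_sin_lt p.1] with N hN
    change tensor k (deriv g) p = dTheta (tensor k (cut g N)) p
    rw [dTheta_tensor k (h.differentiableAt_cut N hp), tensor, tensor,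
      (cut_eventuallyEq_self hp hN).deriv_eq]

lemma gradPhi_cutTest (N : ℕ) (p : Coord) : (gradPhi (h.cutTest N) : Coord → ℂ) p =
    Complex.I * tensor k (fun θ => (k : ℝ) / 2 * cut g N θ / Real.sin θ) p := by
  change (((Real.sin p.1)⁻¹ : ℝ) : ℂ) * dPhi (tensor k (cut g N)) p = _
  rw [dPhi_tensor, tensor, tensor]
  push_cast
  ring

lemma tendsto_gradPhi_cutTest :
    Filter.Tendsto (fun N => toL2 (gradPhi (h.cutTest N))) Filter.atTop
      (nhds h.memLp_div.toLp) := by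
  refine tendsto_toLp_of_dominated (fun N => memLp_testFun (gradPhi (h.cutTest N)))
    h.memLp_div (memLp_rpow_sin.const_mul C) (fun N => ?_) ?_
  · filter_upwards [ae_area] with p hp
    rw [h.gradPhi_cutTest, norm_mul, Complex.norm_I, one_mul, norm_tensor,
      (cut_eventuallyEq hp).self_of_nhds]
    have e : (k : ℝ) / 2 * (cutoff N p.1 * g p.1) / Real.sin p.1 =
      cutoff N p.1 * ((k : ℝ) / 2 * g p.1 / Real.sin p.1) := by ring
    rw [e, abs_mul]
    exact (mul_le_of_le_one_left (abs_nonneg _) (abs_cutoff_le _ _)).trans (h.bound_div _ hp)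
  · filter_upwards [ae_area] with p hp
    refine tendsto_const_nhds.congr' ?_
    filter_upwards [eventually_one_sub_log_sin_lt p.1] with N hN
    rw [h.gradPhi_cutTest, tensor, tensor, (cut_eventuallyEq_self hp hN).self_of_nhds]

lemma mem_formDomain : h.memLp.toLp ∈ formDomain := by
  refine ⟨(h.memLp.toLp, h.memLp_deriv.toLp, h.memLp_div.toLp), ?_, rfl⟩
  refine (Submodule.isClosed_topologicalClosure _).mem_of_tendsto
    (h.tendsto_cutTest.prodMk_nhds (h.tendsto_dTheta_cutTest.prodMk_nhds h.tendsto_gradPhi_cutTest))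
    (Filter.Eventually.of_forall fun N => ?_)
  exact Submodule.le_topologicalClosure _ ⟨h.cutTest N, rfl⟩

/-- A separated function with a solution of the associated ordinary differential equation lies in
the graph of the Laplace–Beltrami operator. -/
theorem mem_friedrichsGraph {lam : ℝ}
    (hode : ∀ θ ∈ Set.Ioo 0 Real.pi, ((k : ℝ) / 2) ^ 2 / Real.sin θ ^ 2 * g θ
      - 1 / Real.sin θ * deriv (fun t => Real.sin t * deriv g t) θ = lam * g θ) :
    (h.memLp.toLp, (lam : ℂ) • h.memLp.toLp) ∈ friedrichsGraph := by
  refine ⟨h.mem_formDomain, fun v => ?_⟩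
  -- Near a point where the cutoff is identically `1`, the Laplacian of the cut-off function is
  -- given by the differential equation for `g`.
  have hlap (N : ℕ) (p : Coord) (hp : p.1 ∈ Set.Ioo 0 Real.pi)
      (hN : 1 - Real.log (Real.sin p.1) < N + 1) :
      (laplaceTest (h.cutTest N) : Coord → ℂ) p = lam * tensor k g p := by
    have hev := cut_eventuallyEq_self (g := g) hp hN
    have hw : ∀ᶠ t in nhds p.1, deriv (cut g N) t = deriv g t := hev.deriv
    rw [laplaceTest_apply]
    change -(1 / (Real.sin p.1 : ℂ) ^ 2) * dPhi (dPhi (tensor k (cut g N))) p - 1 /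
      (Real.sin p.1 : ℂ) * dTheta (fun q => (Real.sin q.1 : ℂ) * dTheta (tensor k (cut g N)) q) p = _
    have e : dTheta (fun q => (Real.sin q.1 : ℂ) * dTheta (tensor k (cut g N)) q) p =
        dTheta (tensor k fun t => Real.sin t * deriv g t) p := by
      refine Filter.EventuallyEq.deriv_eq ?_
      filter_upwards [hw, isOpen_Ioo.mem_nhds hp] with t h1 h2
      rw [dTheta_tensor k (p := (t, p.2)) (h.differentiableAt_cut N h2), tensor, tensor, h1]
      push_cast
      ring
    have hd : DifferentiableAt ℝ (fun t => Real.sin t * deriv g t) p.1 := by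
      have h1 : ContDiffOn ℝ ∞ (deriv g) (Set.Ioo 0 Real.pi) :=
        h.contDiffOn.deriv_of_isOpen isOpen_Ioo (by simp)
      exact Real.differentiableAt_sin.mul
        ((h1.contDiffAt (isOpen_Ioo.mem_nhds hp)).differentiableAt (by simp))
    rw [e, dTheta_tensor k hd, dPhi_dPhi_tensor, tensor, tensor, tensor, hev.self_of_nhds]
    have ho := congrArg (fun x : ℝ => (x : ℂ)) (hode p.1 hp)
    push_cast at ho ⊢
    linear_combination (fourier (T := 4 * Real.pi) k p.2) * ho
  have hT : ContinuousOn (fun p : Coord => 1 - Real.log (Real.sin p.1))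
      (tsupport (v : Coord → ℂ)) := by
    refine continuousOn_const.sub (ContinuousOn.log (by fun_prop) fun p hp => ?_)
    have := (v.2.2.2 hp).1
    exact (Real.sin_pos_of_pos_of_lt_pi this.1 this.2).ne'
  -- The support of `v` stays away from the poles, so for large `N` the cutoff is `1` on all of it
  -- and drops out of the pairing with `v`.
  obtain ⟨M, hM⟩ := v.2.2.1.isCompact.exists_bound_of_continuousOn hT
  obtain ⟨N₀, hN₀⟩ := exists_nat_gt M
  refine tendsto_nhds_unique (Filter.Tendsto.inner tendsto_const_nhds h.tendsto_cutTest)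
    (tendsto_const_nhds.congr' ?_)
  filter_upwards [Filter.eventually_ge_atTop N₀] with N hN
  have hNM : M < N + 1 := by
    have : (N₀ : ℝ) ≤ N := by exact_mod_cast hN
    linarith
  have hs : ⟪toL2 (laplaceTest v), toL2 (h.cutTest N)⟫_ℂ =
      ⟪toL2 v, toL2 (laplaceTest (h.cutTest N))⟫_ℂ := by
    rw [inner_laplaceTest, ← inner_conj_symm (toL2 v), inner_laplaceTest, map_add,
      inner_conj_symm, inner_conj_symm]
  rw [hs, inner_smul_right]
  have e1 : ⟪toL2 v, h.memLp.toLp⟫_ℂ = _ := inner_toLp (memLp_testFun v) h.memLp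
  rw [e1, inner_toL2, ← integral_const_mul]
  refine integral_congr_ae (Filter.Eventually.of_forall fun p => ?_)
  simp only
  by_cases hp : (v : Coord → ℂ) p = 0
  · rw [hp, map_zero, zero_mul, zero_mul, mul_zero]
  · have hp' := subset_tsupport _ hp
    rw [hlap N p (v.2.2.2 hp').1 (((le_abs_self _).trans (hM p hp')).trans_lt hNM)]
    ring

end IsAdmissible

/-! ### Rodrigues polynomials and the Gegenbauer equation. -/

open Polynomial in
/-- The polynomials `Q` with `(d/dx)^i (1 - x²)^(n/2) = (1 - x²)^(n/2 - i) Q_i(x)`. -/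
def rodriguesPoly (n : ℕ) : ℕ → ℝ[X]
  | 0 => 1
  | i + 1 => (1 - X ^ 2) * derivative (rodriguesPoly n i)
      - C ((n : ℝ) - 2 * i) * X * rodriguesPoly n i

open Polynomial in
lemma rodriguesPoly_succ (n i : ℕ) : rodriguesPoly n (i + 1) =
    (1 - X ^ 2) * derivative (rodriguesPoly n i)
      - C ((n : ℝ) - 2 * i) * X * rodriguesPoly n i := rfl

open Polynomial in
/-- The Gegenbauer differential equation. -/
lemma rodriguesPoly_ode (n i : ℕ) :
    (1 - X ^ 2) * derivative (derivative (rodriguesPoly n i))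
      - C ((n : ℝ) - 2 * i + 2) * X * derivative (rodriguesPoly n i)
      + C (i * ((n : ℝ) - i + 1)) * rodriguesPoly n i = 0 := by
  induction i with
  | zero => simp [rodriguesPoly]
  | succ i ih =>
    -- Differentiating the recursion yields the left side of the equation at stage `i`, so the
    -- induction hypothesis collapses it to a multiple of the previous polynomial. The equation at
    -- stage `i + 1` is then the recursion itself.
    have hd : derivative (rodriguesPoly n (i + 1)) =
        -C ((i + 1) * ((n : ℝ) - i)) * rodriguesPoly n i := by
      rw [rodriguesPoly_succ]
      simp only [derivative_sub, derivative_mul, derivative_one, derivative_X_pow, derivative_C,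
        derivative_X]
      simp only [map_mul, map_add, map_sub, map_natCast, map_ofNat, map_one] at ih ⊢
      push_cast
      linear_combination ih
    have hdd : derivative (derivative (rodriguesPoly n (i + 1))) =
        -C ((i + 1) * ((n : ℝ) - i)) * derivative (rodriguesPoly n i) := by
      rw [hd, ← C_neg, derivative_C_mul]
    rw [hdd, hd, rodriguesPoly_succ]
    simp only [map_mul, map_add, map_sub, map_natCast, map_ofNat, map_one]
    push_cast
    ring

open Polynomial in
lemma natDegree_rodriguesPoly_le (n i : ℕ) : (rodriguesPoly n i).natDegree ≤ i := by
  induction i with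
  | zero => simp [rodriguesPoly]
  | succ i ih =>
    rw [rodriguesPoly_succ]
    have h1 : (derivative (rodriguesPoly n i)).natDegree ≤ i - 1 :=
      (natDegree_derivative_le _).trans (Nat.sub_le_sub_right ih 1)
    rcases Nat.eq_zero_or_pos i with rfl | hi
    · simp only [rodriguesPoly, derivative_one, mul_zero, zero_sub]
      compute_degree
    · refine (natDegree_sub_le _ _).trans (max_le ?_ ?_)
      · refine natDegree_mul_le.trans ?_
        have : (1 - X ^ 2 : ℝ[X]).natDegree ≤ 2 := by compute_degree
        omega
      · refine natDegree_mul_le.trans ?_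
        have : (C ((n : ℝ) - 2 * i) * X : ℝ[X]).natDegree ≤ 1 := by compute_degree
        omega

open Polynomial in
-- Each step multiplies the top coefficient by `-i - (n - 2i) = -(n - i)`, which is nonzero as long
-- as `i < n`.
lemma coeff_rodriguesPoly_ne_zero (n i : ℕ) (hi : i ≤ n) : (rodriguesPoly n i).coeff i ≠ 0 := by
  induction i with
  | zero => simp [rodriguesPoly]
  | succ i ih =>
    have h0 : (derivative (rodriguesPoly n i)).coeff (i + 1) = 0 := by
      rw [coeff_derivative, coeff_eq_zero_of_natDegree_lt, zero_mul]
      exact (natDegree_rodriguesPoly_le n i).trans_lt (by omega)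
    have h1 : (X ^ 2 * derivative (rodriguesPoly n i)).coeff (i + 1) =
        i * (rodriguesPoly n i).coeff i := by
      rcases i with _ | i
      · simp [rodriguesPoly]
      · rw [show i + 1 + 1 = i + 2 from rfl, coeff_X_pow_mul, coeff_derivative]
        push_cast
        ring
    have h2 : (rodriguesPoly n (i + 1)).coeff (i + 1) =
        -((n : ℝ) - i) * (rodriguesPoly n i).coeff i := by
      rw [rodriguesPoly_succ, coeff_sub, sub_mul, one_mul, coeff_sub, h0, h1, mul_assoc,
        coeff_C_mul, coeff_X_mul]
      ring
    rw [h2]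
    refine mul_ne_zero (neg_ne_zero.2 (sub_ne_zero.2 ?_)) (ih (by omega))
    exact_mod_cast (by omega : n ≠ i)

lemma rodriguesPoly_ne_zero {n i : ℕ} (hi : i ≤ n) : rodriguesPoly n i ≠ 0 := fun h =>
  coeff_rodriguesPoly_ne_zero n i hi (by rw [h, Polynomial.coeff_zero])

lemma degree_rodriguesPoly {n i : ℕ} (hi : i ≤ n) : (rodriguesPoly n i).degree = i :=
  le_antisymm (Polynomial.natDegree_le_iff_degree_le.1 (natDegree_rodriguesPoly_le n i))
    (Polynomial.le_degree_of_ne_zero (coeff_rodriguesPoly_ne_zero n i hi))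

/-! ### The functions `(sin θ)^μ P(cos θ)` -/

/-- The function `(sin θ)^μ P(cos θ)`. -/
def radial (μ : ℝ) (P : Polynomial ℝ) (θ : ℝ) : ℝ := Real.sin θ ^ μ * P.eval (Real.cos θ)

lemma hasDerivAt_radial (μ : ℝ) (P : Polynomial ℝ) {θ : ℝ} (hθ : θ ∈ Set.Ioo 0 Real.pi) :
    HasDerivAt (radial μ P) (μ * radial (μ - 1) (Polynomial.X * P) θ
      - radial (μ + 1) (Polynomial.derivative P) θ) θ := by
  have hs := Real.sin_pos_of_pos_of_lt_pi hθ.1 hθ.2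
  have h1 := (Real.hasDerivAt_sin θ).rpow_const (p := μ) (Or.inl hs.ne')
  have h2 := (P.hasDerivAt (Real.cos θ)).comp θ (Real.hasDerivAt_cos θ)
  refine (h1.mul h2).congr_deriv ?_
  simp only [radial, Polynomial.eval_mul, Polynomial.eval_X, Real.rpow_add_one hs.ne',
    Function.comp_apply]
  ring

lemma measurable_radial (μ : ℝ) (P : Polynomial ℝ) : Measurable (radial μ P) :=
  (Real.measurable_sin.pow_const μ).mul (P.continuous.measurable.comp Real.measurable_cos)

lemma contDiffOn_radial (μ : ℝ) (P : Polynomial ℝ) :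
    ContDiffOn ℝ ∞ (radial μ P) (Set.Ioo 0 Real.pi) :=
  (contDiffOn_sin.rpow_const_of_ne fun _ hθ =>
    (Real.sin_pos_of_pos_of_lt_pi hθ.1 hθ.2).ne').mul
      ((Polynomial.contDiff_aeval P ∞).comp Real.contDiff_cos).contDiffOn

lemma exists_bound_eval_cos (P : Polynomial ℝ) :
    ∃ C, 0 ≤ C ∧ ∀ θ, |P.eval (Real.cos θ)| ≤ C := by
  obtain ⟨C, hC⟩ := isCompact_Icc.exists_bound_of_continuousOn (s := Set.Icc (-1 : ℝ) 1)
    P.continuous.continuousOn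
  exact ⟨C, (norm_nonneg _).trans (hC 0 (by simp)), fun θ => hC _ (Real.cos_mem_Icc θ)⟩

/-- The only dangerous term is `μ (sin θ)^(μ - 1)`. It is absent for `μ = 0`, and for `μ ≥ 1/2` it
is at most `μ (sin θ)^(-1/2)` because `sin θ ≤ 1`. -/
lemma exists_isAdmissible_radial {μ : ℝ} (hμ : μ = 0 ∨ 1 / 2 ≤ μ) {k : ℤ}
    (hk : |(k : ℝ) / 2| = μ) (P : Polynomial ℝ) : ∃ C, IsAdmissible k (radial μ P) C := by
  obtain ⟨C₀, hC₀, h0⟩ := exists_bound_eval_cos P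
  obtain ⟨C₁, hC₁, h1⟩ := exists_bound_eval_cos (Polynomial.derivative P)
  have hμ0 : 0 ≤ μ := hk ▸ abs_nonneg _
  have key (θ : ℝ) (hθ : θ ∈ Set.Ioo 0 Real.pi) :
      |μ * Real.sin θ ^ (μ - 1) * P.eval (Real.cos θ)| ≤
        μ * C₀ * Real.sin θ ^ (-(1 / 2) : ℝ) := by
    have hs := Real.sin_pos_of_pos_of_lt_pi hθ.1 hθ.2
    rcases hμ with rfl | hμ
    · simp
    · rw [abs_mul, abs_of_nonneg (by positivity)]
      calc μ * Real.sin θ ^ (μ - 1) * |P.eval (Real.cos θ)|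
          ≤ μ * Real.sin θ ^ (-(1 / 2) : ℝ) * C₀ := by
            gcongr ?_ * ?_
            · gcongr μ * ?_
              exact Real.rpow_le_rpow_of_exponent_ge hs (Real.sin_le_one θ) (by linarith)
            · exact h0 θ
        _ = _ := by ring
  refine ⟨C₀ + μ * C₀ + C₁, measurable_radial μ P, contDiffOn_radial μ P, fun θ hθ => ?_,
    fun θ hθ => ?_, fun θ hθ => ?_⟩
  · have hs := Real.sin_pos_of_pos_of_lt_pi hθ.1 hθ.2
    rw [radial, abs_mul, abs_of_nonneg (by positivity)]
    refine (mul_le_of_le_one_left (abs_nonneg _)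
      (Real.rpow_le_one hs.le (Real.sin_le_one θ) hμ0)).trans ((h0 θ).trans ?_)
    nlinarith [mul_nonneg hμ0 hC₀]
  · have hs := Real.sin_pos_of_pos_of_lt_pi hθ.1 hθ.2
    have hb : |radial (μ + 1) (Polynomial.derivative P) θ| ≤ C₁ * Real.sin θ ^ (-(1 / 2) : ℝ) := by
      rw [radial, abs_mul, abs_of_nonneg (by positivity), mul_comm]
      exact mul_le_mul (h1 θ) (Real.rpow_le_rpow_of_exponent_ge hs (Real.sin_le_one θ)
        (by linarith)) (by positivity) hC₁
    have ha : |μ * radial (μ - 1) (Polynomial.X * P) θ| ≤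
        μ * C₀ * Real.sin θ ^ (-(1 / 2) : ℝ) := by
      have e : μ * radial (μ - 1) (Polynomial.X * P) θ =
          Real.cos θ * (μ * Real.sin θ ^ (μ - 1) * P.eval (Real.cos θ)) := by
        rw [radial, Polynomial.eval_mul, Polynomial.eval_X]
        ring
      rw [e, abs_mul]
      exact (mul_le_of_le_one_left (abs_nonneg _) (Real.abs_cos_le_one θ)).trans (key θ hθ)
    rw [(hasDerivAt_radial μ P hθ).deriv]
    refine (abs_sub _ _).trans ((add_le_add ha hb).trans ?_)
    have : 0 ≤ C₀ * Real.sin θ ^ (-(1 / 2) : ℝ) := by positivity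
    linarith
  · have hs := Real.sin_pos_of_pos_of_lt_pi hθ.1 hθ.2
    have e : |(k : ℝ) / 2 * radial μ P θ / Real.sin θ| =
        |μ * Real.sin θ ^ (μ - 1) * P.eval (Real.cos θ)| := by
      rw [radial, Real.rpow_sub_one hs.ne', abs_div, abs_mul, hk, abs_mul, abs_mul _ (P.eval _),
        abs_mul μ, abs_div, abs_of_nonneg hμ0]
      ring
    rw [e]
    refine (key θ hθ).trans ?_
    have : 0 ≤ (C₀ + C₁) * Real.sin θ ^ (-(1 / 2) : ℝ) := by positivity
    linarith

/-- Splitting off the factor `(sin θ)^μ` turns the associated Legendre equation into a Gegenbauer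
equation in `x = cos θ`. -/
lemma radial_ode {μ ν : ℝ} {P : Polynomial ℝ}
    (hP : (1 - Polynomial.X ^ 2) * Polynomial.derivative (Polynomial.derivative P)
      - Polynomial.C (2 * μ + 2) * Polynomial.X * Polynomial.derivative P
      + Polynomial.C ν * P = 0) {θ : ℝ} (hθ : θ ∈ Set.Ioo 0 Real.pi) :
    μ ^ 2 / Real.sin θ ^ 2 * radial μ P θ
      - 1 / Real.sin θ * deriv (fun t => Real.sin t * deriv (radial μ P) t) θ =
        (μ ^ 2 + μ + ν) * radial μ P θ := by
  have hs := Real.sin_pos_of_pos_of_lt_pi hθ.1 hθ.2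
  have hev : (fun t => Real.sin t * deriv (radial μ P) t) =ᶠ[nhds θ]
      fun t => μ * radial μ (Polynomial.X * P) t - radial (μ + 2) (Polynomial.derivative P) t := by
    filter_upwards [isOpen_Ioo.mem_nhds hθ] with t ht
    have hst := Real.sin_pos_of_pos_of_lt_pi ht.1 ht.2
    rw [(hasDerivAt_radial μ P ht).deriv]
    simp only [radial, Real.rpow_sub_one hst.ne', Real.rpow_add hst, Real.rpow_one, Real.rpow_two]
    field_simp
  have hd := ((hasDerivAt_radial μ (Polynomial.X * P) hθ).const_mul μ).sub
    (hasDerivAt_radial (μ + 2) (Polynomial.derivative P) hθ)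
  have hd' : deriv (fun t => μ * radial μ (Polynomial.X * P) t -
    radial (μ + 2) (Polynomial.derivative P) t) θ = _ := hd.deriv
  have hq := congrArg (Polynomial.eval (Real.cos θ)) hP
  simp only [Polynomial.eval_add, Polynomial.eval_sub, Polynomial.eval_mul, Polynomial.eval_pow,
    Polynomial.eval_X, Polynomial.eval_one, Polynomial.eval_C, Polynomial.eval_zero] at hq
  have hc : Real.cos θ ^ 2 = 1 - Real.sin θ ^ 2 := by linarith [Real.sin_sq_add_cos_sq θ]
  have e3 : Real.sin θ ^ (3 : ℝ) = Real.sin θ ^ 3 := by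
    exact_mod_cast Real.rpow_natCast (Real.sin θ) 3
  have em : μ + 2 + 1 = μ + 3 := by ring
  have em' : μ + 2 - 1 = μ + 1 := by ring
  rw [hev.deriv_eq, hd']
  simp only [radial, em, em', Real.rpow_sub_one hs.ne', Real.rpow_add hs, Real.rpow_one, e3,
    Polynomial.derivative_mul, Polynomial.derivative_X, Polynomial.eval_mul, Polynomial.eval_X,
    Polynomial.eval_add, one_mul]
  rw [hc] at hq
  field_simp
  linear_combination (-Real.sin θ ^ 2) * hq - μ ^ 2 * P.eval (Real.cos θ) * hc

/-! ### The functions `ψ` of the Rodrigues formula -/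

/-- In the variable `x = cos θ` the operator is `d/dx` and `(sin θ)^n` is `(1 - x²)^(n/2)`, so each
application lowers the exponent of `sin θ` by two. -/
lemma iterate_rodriguesOp (n i : ℕ) {θ : ℝ} (hθ : θ ∈ Set.Ioo 0 Real.pi) :
    (rodriguesOp^[i] fun t => Real.sin t ^ n) θ = radial ((n : ℝ) - 2 * i) (rodriguesPoly n i) θ := by
  induction i generalizing θ with
  | zero => simp [radial, rodriguesPoly]
  | succ i ih =>
    have hs := Real.sin_pos_of_pos_of_lt_pi hθ.1 hθ.2
    have hev : (rodriguesOp^[i] fun t => Real.sin t ^ n) =ᶠ[nhds θ]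
        radial ((n : ℝ) - 2 * i) (rodriguesPoly n i) := by
      filter_upwards [isOpen_Ioo.mem_nhds hθ] with t ht
      exact ih ht
    have hc : Real.cos θ ^ 2 = 1 - Real.sin θ ^ 2 := by linarith [Real.sin_sq_add_cos_sq θ]
    have e : (n : ℝ) - 2 * (i + 1 : ℕ) = (n : ℝ) - 2 * i - 1 - 1 := by push_cast; ring
    rw [Function.iterate_succ_apply', rodriguesOp, hev.deriv_eq, (hasDerivAt_radial _ _ hθ).deriv,
      rodriguesPoly_succ, e]
    simp only [radial, Real.rpow_sub_one hs.ne', Real.rpow_add hs, Real.rpow_one,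
      Polynomial.eval_mul, Polynomial.eval_X, Polynomial.eval_sub, Polynomial.eval_one,
      Polynomial.eval_pow, Polynomial.eval_C, hc]
    field_simp
    ring

lemma psi_eq_radial (n q : ℕ) {θ : ℝ} (hθ : θ ∈ Set.Ioo 0 Real.pi) :
    psi n q θ = radial ((n : ℝ) / 2 - q) (rodriguesPoly n q) θ := by
  have hs := Real.sin_pos_of_pos_of_lt_pi hθ.1 hθ.2
  have e : (n : ℝ) - 2 * q = ((n : ℝ) / 2 - q) + ((n : ℝ) / 2 - q) := by ring
  have h0 : Real.sin θ ^ ((n : ℝ) / 2 - q) ≠ 0 := (Real.rpow_pos_of_pos hs _).ne'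
  rw [psi, iterate_rodriguesOp n q hθ, radial, radial, e, Real.rpow_add hs]
  field_simp

/-! ### The spherical harmonics are orthonormal eigenfunctions -/

/-- The function `(sin θ)^|m| Q(cos θ)` of the colatitude in `Y_{ℓ,m}`, where `ℓ = n / 2` and
`m = n / 2 - q`. -/
def coreRadial (n q : ℕ) : ℝ → ℝ := radial |(n : ℝ) / 2 - q| (rodriguesPoly n (min q (n - q)))

/-- The spherical harmonics without normalization, for both signs of `m`. -/
def core (n q : ℕ) : Coord → ℂ := tensor ((n : ℤ) - 2 * q) (coreRadial n q)

/-- The degree `ℓ - |m|` of the polynomial factor is `min q (n - q)` for both signs of `m`. -/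
lemma abs_half_sub {n q : ℕ} (hq : q ≤ n) :
    |(n : ℝ) / 2 - q| = (n : ℝ) / 2 - (min q (n - q) : ℕ) := by
  rcases le_total q (n - q) with h | h
  · rw [min_eq_left h, abs_of_nonneg]
    have : (q : ℝ) + q ≤ n := by exact_mod_cast (by omega : q + q ≤ n)
    linarith
  · rw [min_eq_right h, abs_of_nonpos, Nat.cast_sub hq]
    · ring
    · have : (n : ℝ) ≤ q + q := by exact_mod_cast (by omega : n ≤ q + q)
      linarith

/-- Since `2 m` is an integer, `|m|` is either `0` or at least `1/2`. -/
lemma core_isAdmissible (n q : ℕ) :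
    ∃ C, IsAdmissible ((n : ℤ) - 2 * q) (coreRadial n q) C := by
  have hk : ((((n : ℤ) - 2 * q : ℤ) : ℝ) / 2) = (n : ℝ) / 2 - q := by push_cast; ring
  refine exists_isAdmissible_radial ?_ (by rw [hk]) _
  rcases eq_or_ne ((n : ℤ) - 2 * q) 0 with h | h
  · left
    rw [← hk, h]
    simp
  · right
    have h1 : (1 : ℝ) ≤ |(((n : ℤ) - 2 * q : ℤ) : ℝ)| := by exact_mod_cast Int.one_le_abs h
    rw [← hk, abs_div, abs_two]
    linarith

lemma memLp_core (n q : ℕ) : MemLp (core n q) 2 area :=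
  (core_isAdmissible n q).choose_spec.memLp

/-- The eigenvalue `ℓ (ℓ + 1)` for `ℓ = n / 2`. -/
def eigenvalue (n : ℕ) : ℝ := (n : ℝ) / 2 * ((n : ℝ) / 2 + 1)

lemma core_mem_friedrichsGraph {n q : ℕ} (hq : q ≤ n) :
    ((memLp_core n q).toLp, (eigenvalue n : ℂ) • (memLp_core n q).toLp) ∈ friedrichsGraph := by
  obtain ⟨C, hC⟩ := core_isAdmissible n q
  refine hC.mem_friedrichsGraph fun θ hθ => ?_
  have hj : min q (n - q) ≤ n := (min_le_left _ _).trans hq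
  have hode := rodriguesPoly_ode n (min q (n - q))
  have e : ((n : ℝ) - 2 * (min q (n - q) : ℕ) + 2) = 2 * |(n : ℝ) / 2 - q| + 2 := by
    rw [abs_half_sub hq]; ring
  rw [e] at hode
  have h := radial_ode hode hθ
  have hk : ((((n : ℤ) - 2 * q : ℤ) : ℝ) / 2) ^ 2 = |(n : ℝ) / 2 - q| ^ 2 := by
    rw [sq_abs]; push_cast; ring
  -- With `j = ℓ - |m|`, the eigenvalue is `(ℓ - j)² + (ℓ - j) + j (2ℓ - j + 1) = ℓ (ℓ + 1)`.
  rw [hk, coreRadial, h, eigenvalue, abs_half_sub hq]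
  ring

lemma integral_fourier {k : ℤ} (hk : k ≠ 0) :
    ∫ x : AddCircle (4 * Real.pi), fourier k x = 0 :=
  integral_eq_zero_of_add_right_eq_neg (fourier_add_half_inv_index hk Fact.out)

/-- The integral factors, and its angular factor is the integral of a nontrivial character. -/
lemma inner_tensor_of_ne {k k' : ℤ} (hk : k ≠ k') {f f' : ℝ → ℝ} (h : MemLp (tensor k f) 2 area)
    (h' : MemLp (tensor k' f') 2 area) : ⟪h.toLp, h'.toLp⟫_ℂ = 0 := by
  rw [inner_toLp, area]
  have e (p : Coord) : (starRingEnd ℂ) (tensor k f p) * tensor k' f' p =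
      ((f p.1 * f' p.1 : ℝ) : ℂ) * fourier (k' - k) p.2 := by
    rw [sub_eq_add_neg, fourier_add, fourier_neg, tensor, tensor, map_mul, Complex.conj_ofReal]
    push_cast
    ring
  simp only [e]
  rw [integral_prod_mul (fun θ : ℝ => ((f θ * f' θ : ℝ) : ℂ))
    (fun x => fourier (T := 4 * Real.pi) (k' - k) x), integral_fourier (sub_ne_zero.2 hk.symm),
    mul_zero]

lemma inner_eigenvectors_of_ne {u v : L2} {r s : ℝ} (hrs : r ≠ s)
    (hu : (u, (r : ℂ) • u) ∈ friedrichsGraph) (hv : (v, (s : ℂ) • v) ∈ friedrichsGraph) :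
    ⟪u, v⟫_ℂ = 0 := by
  have h := friedrichsGraph_symm hu hv
  simp only [inner_smul_left, inner_smul_right, Complex.conj_ofReal] at h
  have : ((s : ℂ) - r) * ⟪u, v⟫_ℂ = 0 := by rw [sub_mul, h, sub_self]
  exact (mul_eq_zero.1 this).resolve_left (sub_ne_zero.2 (by exact_mod_cast hrs.symm))

lemma eigenvalue_strictMono : StrictMono eigenvalue := by
  intro m n h
  have h' : (m : ℝ) < n := by exact_mod_cast h
  have h0 : (0 : ℝ) ≤ m := Nat.cast_nonneg m
  unfold eigenvalue
  nlinarith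

lemma area_ne_zero : area ≠ 0 := by
  rw [area_eq]
  intro h
  rw [withDensity_eq_zero_iff (by fun_prop)] at h
  have hne : (volume.restrict (Set.Ioo 0 Real.pi)).prod
      (volume : Measure (AddCircle (4 * Real.pi))) ≠ 0 := by
    intro h0
    have := congrArg (fun μ => μ Set.univ) h0
    simp only [← Set.univ_prod_univ, Measure.prod_prod, Measure.restrict_apply_univ,
      Real.volume_Ioo, AddCircle.measure_univ, Measure.coe_zero, Pi.zero_apply, mul_eq_zero,
      ENNReal.ofReal_eq_zero] at this
    rcases this with h | h <;> linarith [Real.pi_pos]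
  have : ∀ᵐ p ∂((volume.restrict (Set.Ioo 0 Real.pi)).prod
      (volume : Measure (AddCircle (4 * Real.pi)))), False := by
    filter_upwards [h, ae_base] with p h1 h2
    have h3 := Real.sin_pos_of_pos_of_lt_pi h2.1 h2.2
    simp only [Pi.zero_apply, ENNReal.ofReal_eq_zero] at h1
    linarith
  exact hne (ae_eq_bot.1 (Filter.eventually_false_iff_eq_bot.1 this))

/-- A nonzero polynomial has finitely many roots and `cos` is injective on `(0, π)`, so the
exceptional colatitudes form a finite set. -/
lemma ae_radial_ne_zero (μ : ℝ) {P : Polynomial ℝ} (hP : P ≠ 0) :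
    ∀ᵐ p ∂area, radial μ P p.1 ≠ 0 := by
  have hfin : {θ | θ ∈ Set.Ioo 0 Real.pi ∧ P.eval (Real.cos θ) = 0}.Finite := by
    refine Set.Finite.of_finite_image (f := Real.cos) ?_ ?_
    · refine (P.rootSet_finite ℝ).subset ?_
      rintro _ ⟨θ, hθ, rfl⟩
      exact (Polynomial.mem_rootSet_of_ne hP).2 (by simpa using hθ.2)
    · exact Real.injOn_cos.mono fun θ hθ => Set.Ioo_subset_Icc_self hθ.1
  have h0 : ∀ᵐ θ ∂((volume.restrict (Set.Ioo 0 Real.pi)).withDensity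
      (fun θ : ℝ => ENNReal.ofReal (Real.sin θ))),
      θ ∉ {θ | θ ∈ Set.Ioo 0 Real.pi ∧ P.eval (Real.cos θ) = 0} := by
    refine (withDensity_absolutelyContinuous _ _).ae_le ?_
    exact ae_restrict_of_ae (hfin.countable.ae_notMem _)
  have h1 : ∀ᵐ p ∂area, p.1 ∉ {θ | θ ∈ Set.Ioo 0 Real.pi ∧ P.eval (Real.cos θ) = 0} :=
    Measure.quasiMeasurePreserving_fst.ae h0
  filter_upwards [h1, ae_area] with p h2 hp
  have hs := Real.sin_pos_of_pos_of_lt_pi hp.1 hp.2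
  exact mul_ne_zero (Real.rpow_pos_of_pos hs _).ne' fun h => h2 ⟨hp, h⟩

lemma eLpNorm_core_ne_zero {n q : ℕ} (hq : q ≤ n) : eLpNorm (core n q) 2 area ≠ 0 := by
  intro h
  rw [eLpNorm_eq_zero_iff (memLp_core n q).1 (by simp)] at h
  have : ∀ᵐ p ∂area, False := by
    filter_upwards [h, ae_radial_ne_zero |(n : ℝ) / 2 - q|
      (rodriguesPoly_ne_zero (n := n) (i := min q (n - q)) ((min_le_left _ _).trans hq))] with p h1 h2
    have h3 := norm_tensor ((n : ℤ) - 2 * q) (coreRadial n q) p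
    rw [show tensor ((n : ℤ) - 2 * q) (coreRadial n q) p = 0 from h1, norm_zero] at h3
    exact h2 (abs_eq_zero.1 h3.symm)
  exact area_ne_zero (ae_eq_bot.1 (Filter.eventually_false_iff_eq_bot.1 this))

lemma harmonicCore_ae {n q : ℕ} (hq : 2 * q ≤ n) : harmonicCore n q =ᵐ[area] core n q := by
  filter_upwards [ae_area] with p hp
  rw [harmonicCore, psi_eq_radial n q hp, core, tensor, coreRadial, abs_half_sub (by omega),
    min_eq_left (by omega)]

/-- The radial factor depends only on `|m|`, so passing from `m` to `-m` only conjugates the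
character. -/
lemma conj_core {n q : ℕ} (hq : q ≤ n) (p : Coord) :
    (starRingEnd ℂ) (core n (n - q) p) = core n q p := by
  have e1 : (n : ℤ) - 2 * ((n - q : ℕ) : ℤ) = -((n : ℤ) - 2 * q) := by omega
  have e2 : coreRadial n (n - q) = coreRadial n q := by
    rw [coreRadial, coreRadial, abs_half_sub hq, abs_half_sub (Nat.sub_le _ _),
      Nat.sub_sub_self hq, min_comm]
  rw [core, core, e1, e2, tensor, tensor, map_mul, Complex.conj_ofReal, fourier_neg,
    Complex.conj_conj]

lemma eLpNorm_core_sub {n q : ℕ} (hq : q ≤ n) :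
    eLpNorm (core n (n - q)) 2 area = eLpNorm (core n q) 2 area := by
  refine eLpNorm_congr_norm_ae (Filter.Eventually.of_forall fun p => ?_)
  rw [← conj_core hq, RCLike.norm_conj]

/-- Spherical harmonics are multiples of `core`, normalized in `L²`. -/
lemma sphericalHarmonic_ae {chat : ℕ → ℕ → ℂ} (hchat : ∀ n q, ‖chat n q‖ = 1) {n q : ℕ}
    (hq : q ≤ n) : ∃ c : ℂ, ‖c‖ * (eLpNorm (core n q) 2 area).toReal = 1 ∧
      sphericalHarmonic chat n q =ᵐ[area] c • core n q := by
  have h0 : (eLpNorm (core n q) 2 area).toReal ≠ 0 :=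
    ENNReal.toReal_ne_zero.2 ⟨eLpNorm_core_ne_zero hq, (memLp_core n q).eLpNorm_lt_top.ne⟩
  have hpos : 0 < (eLpNorm (core n q) 2 area).toReal := lt_of_le_of_ne ENNReal.toReal_nonneg h0.symm
  by_cases h : 2 * q ≤ n
  · refine ⟨((eLpNorm (core n q) 2 area).toReal⁻¹ : ℝ), ?_, ?_⟩
    · rw [Complex.norm_real, Real.norm_of_nonneg (by positivity), inv_mul_cancel₀ h0]
    · filter_upwards [harmonicCore_ae h] with p hp
      rw [sphericalHarmonic, if_pos h, normalizedCore, eLpNorm_congr_ae (harmonicCore_ae h), hp]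
      rfl
  · have h' : 2 * (n - q) ≤ n := by omega
    refine ⟨chat n q * ((eLpNorm (core n q) 2 area).toReal⁻¹ : ℝ), ?_, ?_⟩
    · rw [norm_mul, hchat, one_mul, Complex.norm_real, Real.norm_of_nonneg (by positivity),
        inv_mul_cancel₀ h0]
    · filter_upwards [harmonicCore_ae h'] with p hp
      rw [sphericalHarmonic, if_neg h, normalizedCore, eLpNorm_congr_ae (harmonicCore_ae h'),
        eLpNorm_core_sub hq, hp, map_mul, conj_core hq, Complex.conj_ofReal, ← mul_assoc]
      rfl

lemma memLp_sphericalHarmonic {chat : ℕ → ℕ → ℂ} (hchat : ∀ n q, ‖chat n q‖ = 1) {n q : ℕ}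
    (hq : q ≤ n) : MemLp (sphericalHarmonic chat n q) 2 area := by
  obtain ⟨c, -, hc⟩ := sphericalHarmonic_ae hchat hq
  exact ((memLp_core n q).const_smul c).ae_eq hc.symm

lemma toLp_sphericalHarmonic {chat : ℕ → ℕ → ℂ} (hchat : ∀ n q, ‖chat n q‖ = 1) {n q : ℕ}
    (hq : q ≤ n) : ∃ c : ℂ, ‖c‖ * ‖(memLp_core n q).toLp‖ = 1 ∧
      (memLp_sphericalHarmonic hchat hq).toLp = c • (memLp_core n q).toLp := by
  obtain ⟨c, hc, hae⟩ := sphericalHarmonic_ae hchat hq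
  refine ⟨c, by rw [Lp.norm_toLp, hc], ?_⟩
  rw [← MemLp.toLp_const_smul]
  exact MemLp.toLp_congr _ _ hae

/-- The spherical harmonics as a family in `L²`. -/
def harmonicFamily {chat : ℕ → ℕ → ℂ} (hchat : ∀ n q, ‖chat n q‖ = 1)
    (i : Σ n : ℕ, Fin (n + 1)) : L2 :=
  (memLp_sphericalHarmonic hchat (Nat.le_of_lt_succ i.2.2)).toLp

section Family

variable {chat : ℕ → ℕ → ℂ} (hchat : ∀ n q, ‖chat n q‖ = 1)

lemma harmonicFamily_mem_friedrichsGraph (i : Σ n : ℕ, Fin (n + 1)) :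
    (harmonicFamily hchat i, (eigenvalue i.1 : ℂ) • harmonicFamily hchat i) ∈ friedrichsGraph := by
  obtain ⟨c, -, hc⟩ := toLp_sphericalHarmonic hchat (Nat.le_of_lt_succ i.2.2)
  rw [harmonicFamily, hc, smul_comm]
  exact friedrichsGraph.smul_mem c (core_mem_friedrichsGraph (Nat.le_of_lt_succ i.2.2))

/-- Equal `ℓ`: distinct frequencies `n - 2q` in `φ`. Different `ℓ`: distinct eigenvalues of a
symmetric graph. -/
lemma orthonormal_harmonicFamily : Orthonormal ℂ (harmonicFamily hchat) := by
  refine ⟨fun i => ?_, fun i j hij => ?_⟩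
  · obtain ⟨c, hn, hc⟩ := toLp_sphericalHarmonic hchat (Nat.le_of_lt_succ i.2.2)
    rw [harmonicFamily, hc, norm_smul, hn]
  · by_cases h : i.1 = j.1
    · obtain ⟨n, q⟩ := i
      obtain ⟨n', q'⟩ := j
      obtain rfl : n = n' := h
      obtain ⟨c, -, hc⟩ := toLp_sphericalHarmonic hchat (Nat.le_of_lt_succ q.2)
      obtain ⟨c', -, hc'⟩ := toLp_sphericalHarmonic hchat (Nat.le_of_lt_succ q'.2)
      simp only [harmonicFamily]
      rw [hc, hc', inner_smul_left, inner_smul_right]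
      have hne : (n : ℤ) - 2 * (q : ℕ) ≠ (n : ℤ) - 2 * (q' : ℕ) := by
        intro h
        refine hij ?_
        congr 1
        ext
        omega
      have h0 : ⟪(memLp_core n q).toLp, (memLp_core n q').toLp⟫_ℂ = 0 := inner_tensor_of_ne hne _ _
      rw [h0, mul_zero, mul_zero]
    · exact inner_eigenvectors_of_ne (fun he => h (eigenvalue_strictMono.injective he))
        (harmonicFamily_mem_friedrichsGraph hchat i) (harmonicFamily_mem_friedrichsGraph hchat j)

end Family

/-! ### Completeness of the spherical harmonics -/

/-- The compact space of the coordinates `(cos θ, φ)`. -/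
abbrev CompactCoord : Type := Set.Icc (-1 : ℝ) 1 × AddCircle (4 * Real.pi)

/-- The change of coordinates `(θ, φ) ↦ (cos θ, φ)`. -/
def cosCoord (p : Coord) : CompactCoord := (⟨Real.cos p.1, Real.cos_mem_Icc p.1⟩, p.2)

lemma continuous_cosCoord : Continuous cosCoord := by
  unfold cosCoord
  fun_prop

lemma measurePreserving_cosCoord : MeasurePreserving cosCoord area (area.map cosCoord) :=
  ⟨continuous_cosCoord.measurable, rfl⟩

/-- The change of coordinates `(x, φ) ↦ (arccos x, φ)`. -/
def arccosCoord (p : CompactCoord) : Coord := (Real.arccos p.1, p.2)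

lemma continuous_arccosCoord : Continuous arccosCoord :=
  (Real.continuous_arccos.comp (continuous_subtype_val.comp continuous_fst)).prodMk continuous_snd

lemma arccosCoord_cosCoord : ∀ᵐ p ∂area, arccosCoord (cosCoord p) = p := by
  filter_upwards [ae_area] with p hp
  exact Prod.ext (Real.arccos_cos hp.1.le hp.2.le) rfl

lemma measurePreserving_arccosCoord : MeasurePreserving arccosCoord (area.map cosCoord) area := by
  refine ⟨continuous_arccosCoord.measurable, ?_⟩
  rw [Measure.map_map continuous_arccosCoord.measurable continuous_cosCoord.measurable]
  have : Measure.map (arccosCoord ∘ cosCoord) area = Measure.map id area :=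
    Measure.map_congr arccosCoord_cosCoord
  rw [this, Measure.map_id]

instance isFiniteMeasure_map_cosCoord : IsFiniteMeasure (area.map cosCoord) :=
  Measure.isFiniteMeasure_map _ _

/-- Continuous functions of `(cos θ, φ)` as elements of `L²`. -/
def ofContinuous : C(CompactCoord, ℂ) →L[ℂ] L2 :=
  (Lp.compMeasurePreservingₗᵢ ℂ cosCoord measurePreserving_cosCoord).toContinuousLinearMap ∘L
    ContinuousMap.toLp 2 (area.map cosCoord) ℂ

lemma ofContinuous_ae (F : C(CompactCoord, ℂ)) :
    ofContinuous F =ᵐ[area] fun p => F (cosCoord p) := by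
  refine (Lp.coeFn_compMeasurePreserving _ measurePreserving_cosCoord).trans ?_
  exact measurePreserving_cosCoord.quasiMeasurePreserving.ae_eq_comp
    (ContinuousMap.coeFn_toLp (p := 2) (𝕜 := ℂ) (area.map cosCoord) F)

lemma memLp_comp_cosCoord (F : C(CompactCoord, ℂ)) : MemLp (fun p => F (cosCoord p)) 2 area :=
  (Lp.memLp (ofContinuous F)).ae_eq (ofContinuous_ae F)

lemma ofContinuous_eq (F : C(CompactCoord, ℂ)) :
    ofContinuous F = (memLp_comp_cosCoord F).toLp := by
  refine Lp.ext ((ofContinuous_ae F).trans ?_)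
  exact (MemLp.coeFn_toLp _).symm

/-- The coordinates `(cos θ, φ)` are invertible almost everywhere, so composition with them is onto
`L²`; continuous functions are dense in `L²` of a finite measure on a compact space. -/
lemma denseRange_ofContinuous : DenseRange ofContinuous := by
  have hs : Function.Surjective
      (Lp.compMeasurePreservingₗᵢ (E := ℂ) (p := 2) ℂ cosCoord measurePreserving_cosCoord) := by
    intro f
    refine ⟨Lp.compMeasurePreserving arccosCoord measurePreserving_arccosCoord f, ?_⟩
    refine Lp.ext ?_
    refine (Lp.coeFn_compMeasurePreserving _ measurePreserving_cosCoord).trans ?_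
    refine (measurePreserving_cosCoord.quasiMeasurePreserving.ae_eq_comp
      (Lp.coeFn_compMeasurePreserving f measurePreserving_arccosCoord)).trans ?_
    filter_upwards [arccosCoord_cosCoord] with p hp
    simp only [Function.comp_apply, hp]
  exact hs.denseRange.comp (ContinuousMap.toLp_denseRange ℂ (area.map cosCoord) ℂ (by simp))
    (LinearIsometry.continuous _)

/-- The function `exp (i k φ / 2) h(x)`. -/
def contTensor (k : ℤ) (h : C(Set.Icc (-1 : ℝ) 1, ℝ)) : C(CompactCoord, ℂ) where
  toFun p := fourier (T := 4 * Real.pi) k p.2 * (h p.1 : ℂ)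
  continuous_toFun := by fun_prop

lemma contTensor_mul (k k' : ℤ) (h h' : C(Set.Icc (-1 : ℝ) 1, ℝ)) :
    contTensor k h * contTensor k' h' = contTensor (k + k') (h * h') := by
  ext p
  change fourier k p.2 * (h p.1 : ℂ) * (fourier k' p.2 * (h' p.1 : ℂ)) =
    fourier (k + k') p.2 * ((h p.1 * h' p.1 : ℝ) : ℂ)
  rw [fourier_add]
  push_cast
  ring

lemma star_contTensor (k : ℤ) (h : C(Set.Icc (-1 : ℝ) 1, ℝ)) :
    star (contTensor k h) = contTensor (-k) h := by
  ext p
  change (starRingEnd ℂ) (fourier k p.2 * (h p.1 : ℂ)) = fourier (-k) p.2 * (h p.1 : ℂ)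
  rw [map_mul, Complex.conj_ofReal, fourier_neg]

lemma continuous_contTensor (k : ℤ) : Continuous (contTensor k) := by
  refine ContinuousMap.continuous_of_continuous_uncurry _ ?_
  change Continuous fun q : C(Set.Icc (-1 : ℝ) 1, ℝ) × CompactCoord =>
    fourier (T := 4 * Real.pi) k q.2.2 * ((q.1 q.2.1 : ℝ) : ℂ)
  fun_prop

/-- Linear combinations of separated functions are dense. -/
lemma mem_of_contTensor_mem {W : Submodule ℂ C(CompactCoord, ℂ)}
    (hW : IsClosed (W : Set C(CompactCoord, ℂ))) (h : ∀ k f, contTensor k f ∈ W)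
    (F : C(CompactCoord, ℂ)) : F ∈ W := by
  let S : Set C(CompactCoord, ℂ) := {F | ∃ k f, F = contTensor k f}
  let A : StarSubalgebra ℂ C(CompactCoord, ℂ) :=
    { toSubalgebra := Algebra.adjoin ℂ S
      star_mem' := by
        change Algebra.adjoin ℂ S ≤ star (Algebra.adjoin ℂ S)
        refine Algebra.adjoin_le ?_
        rintro _ ⟨k, f, rfl⟩
        refine Algebra.subset_adjoin ⟨-k, f, star_contTensor k f⟩ }
  -- Products of separated functions are separated, so the generated algebra is only the linear
  -- span.
  have hspan : Subalgebra.toSubmodule A.toSubalgebra = Submodule.span ℂ S := by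
    apply Algebra.adjoin_eq_span_of_subset
    refine Set.Subset.trans ?_ Submodule.subset_span
    intro x hx
    refine Submonoid.closure_induction (fun _ => id) ⟨0, 1, ?_⟩ ?_ hx
    · ext p
      change (1 : ℂ) = fourier 0 p.2 * ((1 : ℝ) : ℂ)
      simp
    · rintro _ _ _ _ ⟨k, f, rfl⟩ ⟨k', f', rfl⟩
      exact ⟨k + k', f * f', contTensor_mul _ _ _ _⟩
  -- The character `exp (i φ / 2)` is injective on `ℝ / 4πℤ`, and the coordinate `x` separates the
  -- rest.
  have hsep : A.SeparatesPoints := by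
    intro x y hxy
    by_cases hx : x.1 = y.1
    · have h2 : x.2 ≠ y.2 := fun h => hxy (Prod.ext hx h)
      refine ⟨_, ⟨contTensor 1 1, Algebra.subset_adjoin ⟨1, 1, rfl⟩, rfl⟩, ?_⟩
      change fourier 1 x.2 * ((1 : ℝ) : ℂ) ≠ fourier 1 y.2 * ((1 : ℝ) : ℂ)
      rw [Complex.ofReal_one, mul_one, mul_one, fourier_one, fourier_one]
      contrapose h2
      exact AddCircle.injective_toCircle (by positivity) (Circle.ext h2)
    · refine ⟨_, ⟨contTensor 0 ⟨fun t => (t : ℝ), continuous_subtype_val⟩,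
        Algebra.subset_adjoin ⟨0, _, rfl⟩, rfl⟩, ?_⟩
      change fourier 0 x.2 * (((x.1 : ℝ)) : ℂ) ≠ fourier 0 y.2 * (((y.1 : ℝ)) : ℂ)
      rw [fourier_zero, fourier_zero, one_mul, one_mul]
      exact fun h => hx (Subtype.ext (Complex.ofReal_injective h))
  have htop := ContinuousMap.starSubalgebra_topologicalClosure_eq_top_of_separatesPoints A hsep
  have hF : F ∈ A.topologicalClosure := htop ▸ trivial
  refine closure_minimal (s := (A : Set C(CompactCoord, ℂ))) ?_ hW hF
  intro G hG
  have hG' : G ∈ Submodule.span ℂ S := hspan ▸ hG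
  refine Submodule.span_le.2 ?_ hG'
  rintro _ ⟨k, f, rfl⟩
  exact h k f

/-- The function `(sin θ)^μ` as a function of `x = cos θ`. -/
def sinPow (μ : ℝ) (hμ : 0 ≤ μ) : C(Set.Icc (-1 : ℝ) 1, ℝ) where
  toFun x := Real.sqrt (1 - (x : ℝ) ^ 2) ^ μ
  continuous_toFun := by
    refine Continuous.rpow_const (by fun_prop) fun _ => Or.inr hμ

lemma sinPow_cos {μ : ℝ} (hμ : 0 ≤ μ) {θ : ℝ} (hθ : θ ∈ Set.Ioo 0 Real.pi) :
    sinPow μ hμ ⟨Real.cos θ, Real.cos_mem_Icc θ⟩ = Real.sin θ ^ μ := by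
  change Real.sqrt (1 - Real.cos θ ^ 2) ^ μ = _
  rw [← Real.abs_sin_eq_sqrt_one_sub_cos_sq,
    abs_of_pos (Real.sin_pos_of_pos_of_lt_pi hθ.1 hθ.2)]

section Completeness

variable {V : Submodule ℂ L2} (hV : ∀ n q, q ≤ n → (memLp_core n q).toLp ∈ V)
include hV

lemma ofContinuous_core_mem (k : ℤ) (j : ℕ) :
    ofContinuous (contTensor k (sinPow |(k : ℝ) / 2| (abs_nonneg _) *
      (rodriguesPoly (k.natAbs + 2 * j) j).toContinuousMapOn _)) ∈ V := by
  -- At frequency `k = 2m`, degree `j = ℓ - |m|` means `n = |k| + 2j`. Then `q = ℓ - m` is `j` or `j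
  -- + |k|` according to the sign of `k`.
  obtain ⟨q, hq, hk, hj⟩ : ∃ q, q ≤ k.natAbs + 2 * j ∧
      ((k.natAbs + 2 * j : ℕ) : ℤ) - 2 * q = k ∧ min q (k.natAbs + 2 * j - q) = j := by
    rcases le_total 0 k with h | h
    · exact ⟨j, by omega, by omega, by omega⟩
    · exact ⟨j + k.natAbs, by omega, by omega, by omega⟩
  convert hV (k.natAbs + 2 * j) q hq
  rw [ofContinuous_eq]
  refine MemLp.toLp_congr _ _ ?_
  filter_upwards [ae_area] with p hp
  have hkr : ((k.natAbs + 2 * j : ℕ) : ℝ) / 2 - q = (k : ℝ) / 2 := by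
    have : (((k.natAbs + 2 * j : ℕ) : ℤ) : ℝ) - 2 * q = k := by exact_mod_cast hk
    rw [← this, Int.cast_natCast]
    ring
  rw [core, coreRadial, hj, hk, hkr, tensor, radial]
  change fourier k p.2 * ((sinPow _ _ ⟨Real.cos p.1, _⟩ * _ : ℝ) : ℂ) = _
  rw [sinPow_cos (abs_nonneg _) hp]
  rfl

/-- At fixed frequency there is one polynomial of each exact degree `j`, so together they span all
polynomials. -/
lemma ofContinuous_polynomial_mem (k : ℤ) (P : Polynomial ℝ) :
    ofContinuous (contTensor k (sinPow |(k : ℝ) / 2| (abs_nonneg _) *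
      P.toContinuousMapOn _)) ∈ V := by
  let S : Polynomial.Sequence ℝ := ⟨fun j => rodriguesPoly (k.natAbs + 2 * j) j,
    fun j => degree_rodriguesPoly (by omega)⟩
  have hS := S.span fun j => (Polynomial.leadingCoeff_ne_zero.2 (S.ne_zero j)).isUnit
  have hP : P ∈ Submodule.span ℝ (Set.range S) := hS ▸ trivial
  induction hP using Submodule.span_induction with
  | mem P hP =>
    obtain ⟨j, rfl⟩ := hP
    exact ofContinuous_core_mem hV k j
  | zero =>
    convert V.zero_mem
    rw [← map_zero ofContinuous]
    congr 1
    ext p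
    simp [contTensor]
  | add P Q _ _ hP hQ =>
    convert V.add_mem hP hQ
    rw [← map_add]
    congr 1
    ext p
    simp [contTensor]
    ring
  | smul c P _ hP =>
    convert V.smul_mem (c : ℂ) hP
    rw [← map_smul]
    congr 1
    ext p
    simp [contTensor]
    ring

variable (hcl : IsClosed (V : Set L2))
include hcl

lemma ofContinuous_sinPow_mem (k : ℤ) (f : C(Set.Icc (-1 : ℝ) 1, ℝ)) :
    ofContinuous (contTensor k (sinPow |(k : ℝ) / 2| (abs_nonneg _) * f)) ∈ V := by
  have hcont : Continuous fun f : C(Set.Icc (-1 : ℝ) 1, ℝ) =>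
      ofContinuous (contTensor k (sinPow |(k : ℝ) / 2| (abs_nonneg _) * f)) :=
    ofContinuous.continuous.comp ((continuous_contTensor k).comp (continuous_const.mul continuous_id))
  have hf : f ∈ (polynomialFunctions (Set.Icc (-1 : ℝ) 1)).topologicalClosure :=
    polynomialFunctions_closure_eq_top (-1) 1 ▸ trivial
  refine closure_minimal ?_ (hcl.preimage hcont) hf
  rintro _ ⟨P, -, rfl⟩
  exact ofContinuous_polynomial_mem hV k P

/-- The weight `s` may vanish at the poles, so `f / s` need not be continuous. Its regularization `s
f / (s² + 1/(N+1))` is, and multiplied by `s` it is dominated by `|f|` and converges to `f` almost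
everywhere. -/
lemma ofContinuous_contTensor_mem (k : ℤ) (f : C(Set.Icc (-1 : ℝ) 1, ℝ)) :
    ofContinuous (contTensor k f) ∈ V := by
  set s := sinPow |(k : ℝ) / 2| (abs_nonneg _) with hs
  have hden (N : ℕ) (x) : 0 < s x ^ 2 + 1 / ((N : ℝ) + 1) := by positivity
  let fN (N : ℕ) : C(Set.Icc (-1 : ℝ) 1, ℝ) :=
    ⟨fun x => s x * f x / (s x ^ 2 + 1 / ((N : ℝ) + 1)),
      Continuous.div (by fun_prop) (by fun_prop) fun x => (hden N x).ne'⟩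
  have hval (N : ℕ) (p : CompactCoord) : contTensor k (s * fN N) p =
      ((s p.1 ^ 2 / (s p.1 ^ 2 + 1 / ((N : ℝ) + 1)) : ℝ) : ℂ) * contTensor k f p := by
    change fourier k p.2 * ((s p.1 * (s p.1 * f p.1 / (s p.1 ^ 2 + 1 / ((N : ℝ) + 1))) : ℝ) : ℂ) =
      _ * (fourier k p.2 * (f p.1 : ℂ))
    push_cast
    ring
  have hlim : Filter.Tendsto (fun N => ofContinuous (contTensor k (s * fN N))) Filter.atTop
      (nhds (ofContinuous (contTensor k f))) := by
    simp only [ofContinuous_eq]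
    refine tendsto_toLp_of_dominated _ _ (memLp_comp_cosCoord (contTensor k f)).norm
      (fun N => Filter.Eventually.of_forall fun p => ?_) ?_
    · rw [hval, norm_mul, Complex.norm_real, Real.norm_of_nonneg
        (div_nonneg (sq_nonneg _) (hden N _).le)]
      refine mul_le_of_le_one_left (norm_nonneg _) ((div_le_one (hden N _)).2 ?_)
      have : 0 < 1 / ((N : ℝ) + 1) := by positivity
      linarith
    · filter_upwards [ae_area] with p hp
      have hsp : s (cosCoord p).1 ^ 2 ≠ 0 := by
        refine pow_ne_zero _ ?_
        rw [hs]
        refine (sinPow_cos (abs_nonneg _) hp).trans_ne ?_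
        exact (Real.rpow_pos_of_pos (Real.sin_pos_of_pos_of_lt_pi hp.1 hp.2) _).ne'
      simp only [hval]
      have h1 : Filter.Tendsto (fun N : ℕ => s (cosCoord p).1 ^ 2 /
          (s (cosCoord p).1 ^ 2 + 1 / ((N : ℝ) + 1))) Filter.atTop (nhds 1) := by
        have := (tendsto_const_nhds (x := s (cosCoord p).1 ^ 2)).div
          ((tendsto_const_nhds (x := s (cosCoord p).1 ^ 2)).add
            tendsto_one_div_add_atTop_nhds_zero_nat) (by simpa using hsp)
        rwa [add_zero, div_self hsp] at this
      have h2 := (Complex.continuous_ofReal.tendsto 1).comp h1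
      simpa using h2.mul_const (contTensor k f (cosCoord p))
  exact hcl.mem_of_tendsto hlim
    (Filter.Eventually.of_forall fun N => ofContinuous_sinPow_mem hV hcl k _)

lemma eq_top_of_core_mem : V = ⊤ := by
  rw [eq_top_iff]
  intro u _
  refine denseRange_ofContinuous.induction_on (p := fun u => u ∈ V) u hcl fun F => ?_
  exact mem_of_contTensor_mem (W := V.comap (ofContinuous : C(CompactCoord, ℂ) →ₗ[ℂ] L2))
    (hcl.preimage ofContinuous.continuous) (ofContinuous_contTensor_mem hV hcl) F

end Completeness

/-! ### Spectral decomposition of the Laplace–Beltrami operator -/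

section Decomposition

variable {chat : ℕ → ℕ → ℂ} (hchat : ∀ n q, ‖chat n q‖ = 1)

/-- The Hilbert basis of spherical harmonics. -/
def harmonicBasis : HilbertBasis (Σ n : ℕ, Fin (n + 1)) ℂ L2 :=
  HilbertBasis.mk (orthonormal_harmonicFamily hchat) <| by
    rw [top_le_iff]
    refine eq_top_of_core_mem (fun n q hq => ?_) (Submodule.isClosed_topologicalClosure _)
    refine Submodule.le_topologicalClosure _ ?_
    obtain ⟨c, hn, hc⟩ := toLp_sphericalHarmonic hchat hq
    have hc0 : c ≠ 0 := by
      rintro rfl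
      simp at hn
    have : (memLp_core n q).toLp =
        c⁻¹ • harmonicFamily hchat ⟨n, ⟨q, Nat.lt_succ_of_le hq⟩⟩ := by
      rw [harmonicFamily, hc, inv_smul_smul₀ hc0]
    rw [this]
    exact Submodule.smul_mem _ _ (Submodule.subset_span ⟨_, rfl⟩)

lemma harmonicBasis_apply (i : Σ n : ℕ, Fin (n + 1)) :
    harmonicBasis hchat i = harmonicFamily hchat i := by
  rw [harmonicBasis, HilbertBasis.coe_mk]

/-- The Laplace–Beltrami operator is diagonal in the basis of spherical harmonics. -/
lemma mem_friedrichsGraph_iff (p : L2 × L2) : p ∈ friedrichsGraph ↔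
    ∀ i, ⟪harmonicBasis hchat i, p.2⟫_ℂ = eigenvalue i.1 * ⟪harmonicBasis hchat i, p.1⟫_ℂ := by
  have h1 (i : Σ n : ℕ, Fin (n + 1)) :
      (harmonicBasis hchat i, (eigenvalue i.1 : ℂ) • harmonicBasis hchat i) ∈ friedrichsGraph := by
    rw [harmonicBasis_apply]
    exact harmonicFamily_mem_friedrichsGraph hchat i
  refine mem_diagonal_graph_iff isClosed_friedrichsGraph h1 (fun p hp i => ?_) p
  -- Symmetry against an eigenpair with real eigenvalue is exactly the coefficient relation.
  have := friedrichsGraph_symm (h1 i) hp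
  rwa [inner_smul_left, Complex.conj_ofReal] at this

lemma span_harmonicFamily (n : ℕ) :
    Submodule.span ℂ (Set.range fun q : Fin (n + 1) => harmonicFamily hchat ⟨n, q⟩) =
      eigenspace laplacian (eigenvalue n : ℂ) := by
  have h := eigenspace_eq_span (mem_friedrichsGraph_iff hchat) (z := (eigenvalue n : ℂ))
    (κ := Fin (n + 1)) (fun q => ⟨n, q⟩) (fun i => ?_)
  · simp only [harmonicBasis_apply] at h
    exact h
  · rw [Complex.ofReal_inj, eigenvalue_strictMono.injective.eq_iff]
    constructor
    · obtain ⟨m, q⟩ := i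
      rintro rfl
      exact ⟨q, rfl⟩
    · rintro ⟨q, rfl⟩
      rfl

end Decomposition

/-! ### Multiplicities and the spectrum. -/

lemma norm_one_const : ∀ _ _ : ℕ, ‖(1 : ℂ)‖ = 1 := fun _ _ => norm_one

/-- The phases do not affect the operator, so the basis with all phases `1` serves to count
dimensions. -/
lemma finrank_eigenspace (n : ℕ) :
    Module.finrank ℂ (eigenspace laplacian (eigenvalue n : ℂ)) = n + 1 := by
  have ho := (orthonormal_harmonicFamily norm_one_const).linearIndependent.comp
    (fun q : Fin (n + 1) => (⟨n, q⟩ : Σ n : ℕ, Fin (n + 1)))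
        (sigma_mk_injective (β := fun n : ℕ => Fin (n + 1)) (i := n))
  rw [← span_harmonicFamily norm_one_const]
  exact (finrank_span_eq_card ho).trans (Fintype.card_fin _)

instance finite_eigenspace (n : ℕ) :
    Module.Finite ℂ (eigenspace laplacian (eigenvalue n : ℂ)) :=
  Module.finite_of_finrank_pos (by rw [finrank_eigenspace]; omega)

lemma eigenspace_eq_bot {z : ℂ} (hz : ∀ n, (eigenvalue n : ℂ) ≠ z) :
    eigenspace laplacian z = ⊥ := by
  rw [eq_bot_iff]
  intro u hu
  have h := (mem_eigenspace_of_diagonal (mem_friedrichsGraph_iff norm_one_const)).1 hu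
  refine hilbertBasis_ext_inner (b := harmonicBasis norm_one_const) fun i => ?_
  rw [h i (hz i.1), inner_zero_right]

lemma tendsto_eigenvalue : Filter.Tendsto eigenvalue Filter.atTop Filter.atTop := by
  refine Filter.tendsto_atTop_mono (f := fun n : ℕ => (n : ℝ) / 2) (fun n => ?_)
    (tendsto_natCast_atTop_atTop.atTop_div_const (by norm_num))
  have h0 : (0 : ℝ) ≤ n := Nat.cast_nonneg n
  rw [eigenvalue]
  nlinarith

/-- The distances to `z` tend to infinity, so their infimum is attained and hence positive. -/
lemma eigenvalue_gap {z : ℂ} (hz : ∀ n, (eigenvalue n : ℂ) ≠ z) :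
    ∃ δ > 0, ∀ n, δ ≤ ‖(eigenvalue n : ℂ) - z‖ := by
  have ht : Filter.Tendsto (fun n => ‖(eigenvalue n : ℂ) - z‖) Filter.cofinite Filter.atTop := by
    rw [Nat.cofinite_eq_atTop]
    refine Filter.tendsto_atTop_mono (f := fun n => eigenvalue n + -‖z‖) (fun n => ?_)
      (Filter.tendsto_atTop_add_const_right _ _ tendsto_eigenvalue)
    have h1 : eigenvalue n ≤ ‖(eigenvalue n : ℂ)‖ := by
      rw [Complex.norm_real]; exact le_abs_self _
    have h2 := norm_sub_norm_le (eigenvalue n : ℂ) z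
    linarith
  obtain ⟨n₀, h⟩ := ht.exists_forall_le
  exact ⟨_, norm_pos_iff.2 (sub_ne_zero.2 (hz n₀)), h⟩

lemma unboundedSpectrum_laplacian :
    unboundedSpectrum laplacian = Set.range fun n => (eigenvalue n : ℂ) := by
  have h := unboundedSpectrum_of_diagonal (mem_friedrichsGraph_iff norm_one_const) fun z hz => by
    obtain ⟨δ, hδ, h⟩ := eigenvalue_gap (z := z) fun n => hz ⟨n, 0⟩
    exact ⟨δ, hδ, fun i => h i.1⟩
  refine h.trans (Set.ext fun z => ⟨?_, ?_⟩)
  · rintro ⟨i, rfl⟩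
    exact ⟨i.1, rfl⟩
  · rintro ⟨n, rfl⟩
    exact ⟨⟨n, 0⟩, rfl⟩

/-! ### The antisymmetric part -/

/-- The shift by `2π` multiplies by `exp (iπ (n - 2q))`, whose value does not depend on `q`; hence
whole eigenspaces are symmetric or antisymmetric. -/
lemma core_deck (n q : ℕ) (p : Coord) : core n q (deck p) = (-1) ^ n * core n q p := by
  have h : fourier (T := 4 * Real.pi) ((n : ℤ) - 2 * q)
      ((2 * Real.pi : ℝ) : AddCircle (4 * Real.pi)) = (-1) ^ n := by
    rw [fourier_four_pi]
    have e : (((n : ℤ) - 2 * q : ℤ) : ℂ) / 2 * Complex.I * ((2 * Real.pi : ℝ) : ℂ) =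
        n * (Real.pi * Complex.I) - q * (2 * Real.pi * Complex.I) := by
      push_cast
      ring
    rw [e, Complex.exp_sub, Complex.exp_nat_mul, Complex.exp_pi_mul_I,
      Complex.exp_nat_mul, Complex.exp_two_pi_mul_I, one_pow, div_one]
  rw [core, tensor, tensor, deck, fourier_add_arg, h]
  ring

lemma compDeck_core (n q : ℕ) :
    Lp.compMeasurePreservingₗ ℂ deck measurePreserving_deck (memLp_core n q).toLp =
      (-1 : ℂ) ^ n • (memLp_core n q).toLp := by
  refine Lp.ext ?_
  refine (Lp.coeFn_compMeasurePreserving _ measurePreserving_deck).trans ?_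
  refine (measurePreserving_deck.quasiMeasurePreserving.ae_eq_comp
    (memLp_core n q).coeFn_toLp).trans ?_
  filter_upwards [Lp.coeFn_smul ((-1 : ℂ) ^ n) (memLp_core n q).toLp, (memLp_core n q).coeFn_toLp]
    with p h1 h2
  rw [h1, Pi.smul_apply, h2]
  exact core_deck n q p

lemma compDeck_of_mem_eigenspace {n : ℕ} {u : L2}
    (hu : u ∈ eigenspace laplacian (eigenvalue n : ℂ)) :
    Lp.compMeasurePreservingₗ ℂ deck measurePreserving_deck u = (-1 : ℂ) ^ n • u := by
  rw [← span_harmonicFamily norm_one_const] at hu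
  induction hu using Submodule.span_induction with
  | mem v hv =>
    obtain ⟨q, rfl⟩ := hv
    obtain ⟨c, -, hc⟩ := toLp_sphericalHarmonic norm_one_const (Nat.le_of_lt_succ q.2)
    simp only [harmonicFamily]
    rw [hc, map_smul, compDeck_core, smul_comm]
  | zero => rw [map_zero, smul_zero]
  | add v w _ _ hv hw => rw [map_add, hv, hw, smul_add]
  | smul c v _ hv => rw [map_smul, hv, smul_comm]

lemma mem_eigenspace_antisymmetricLaplacian {z : ℂ} {u : L2} :
    u ∈ eigenspace antisymmetricLaplacian z ↔
      u ∈ eigenspace laplacian z ∧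
        Lp.compMeasurePreservingₗ ℂ deck measurePreserving_deck u + u = 0 := by
  rw [mem_eigenspace_iff, mem_eigenspace_iff, LinearPMap.mem_graph_iff, LinearPMap.mem_graph_iff]
  constructor
  · rintro ⟨⟨y, hy⟩, rfl, h⟩
    exact ⟨⟨⟨y, hy.2⟩, rfl, h⟩, hy.1⟩
  · rintro ⟨⟨⟨y, hy⟩, rfl, h⟩, ha⟩
    exact ⟨⟨y, ha, hy⟩, rfl, h⟩

lemma eigenspace_antisymmetricLaplacian_of_odd {n : ℕ} (hn : Odd n) :
    eigenspace antisymmetricLaplacian (eigenvalue n : ℂ) =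
      eigenspace laplacian (eigenvalue n : ℂ) := by
  ext u
  rw [mem_eigenspace_antisymmetricLaplacian, and_iff_left_iff_imp]
  intro hu
  rw [compDeck_of_mem_eigenspace hu, hn.neg_one_pow, neg_one_smul, neg_add_cancel]

lemma eigenspace_antisymmetricLaplacian_of_even {n : ℕ} (hn : Even n) :
    eigenspace antisymmetricLaplacian (eigenvalue n : ℂ) = ⊥ := by
  rw [eq_bot_iff]
  intro u hu
  obtain ⟨h1, h2⟩ := mem_eigenspace_antisymmetricLaplacian.1 hu
  rw [compDeck_of_mem_eigenspace h1, hn.neg_one_pow, one_smul, ← two_smul ℂ] at h2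
  exact (smul_eq_zero.1 h2).resolve_left two_ne_zero

lemma isKthEigenvalue_antisymmetricLaplacian :
    IsKthEigenvalue antisymmetricLaplacian 3 (15 / 4) := by
  have h3 : eigenvalue 3 = 15 / 4 := by norm_num [eigenvalue]
  constructor
  -- Below `15/4` only `n = 1` is odd, contributing dimension `2 < 3`.
  · have hle : (⨆ (s : ℝ) (_ : s < 15 / 4), eigenspace antisymmetricLaplacian s) ≤
        eigenspace laplacian (eigenvalue 1 : ℂ) := by
      refine iSup₂_le fun s hs => ?_
      by_cases hex : ∃ n, eigenvalue n = s
      · obtain ⟨n, rfl⟩ := hex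
        rw [← h3, eigenvalue_strictMono.lt_iff_lt] at hs
        rcases Nat.even_or_odd n with hn | hn
        · rw [eigenspace_antisymmetricLaplacian_of_even hn]
          exact bot_le
        · obtain rfl : n = 1 := by
            obtain ⟨k, rfl⟩ := hn
            omega
          exact (eigenspace_antisymmetricLaplacian_of_odd hn).le
      · push Not at hex
        intro u hu
        have := (mem_eigenspace_antisymmetricLaplacian.1 hu).1
        rw [eigenspace_eq_bot fun n h => hex n (Complex.ofReal_injective h)] at this
        rw [(Submodule.mem_bot ℂ).1 this]
        exact zero_mem _
    refine (Submodule.rank_mono hle).trans_lt ?_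
    rw [← Module.finrank_eq_rank, finrank_eigenspace]
    exact_mod_cast (by norm_num : 1 + 1 < 3)
  -- The eigenspace for `n = 3` alone already has dimension `4 ≥ 3`.
  · have hle : eigenspace laplacian (eigenvalue 3 : ℂ) ≤
        ⨆ (s : ℝ) (_ : s ≤ 15 / 4), eigenspace antisymmetricLaplacian s := by
      rw [← eigenspace_antisymmetricLaplacian_of_odd (by decide)]
      exact le_iSup₂_of_le (eigenvalue 3) h3.le le_rfl
    refine le_trans ?_ (Submodule.rank_mono hle)
    rw [← Module.finrank_eq_rank, finrank_eigenspace]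
    exact_mod_cast (by norm_num : 3 ≤ 3 + 1)

end HalfSphere

end

theorem mainTheorem7 :
    HalfSphere.unboundedSpectrum HalfSphere.laplacian =
      {z : ℂ | ∃ n : ℕ, z = ((n : ℂ) / 2) * ((n : ℂ) / 2 + 1)} ∧
    (∀ n : ℕ, Module.finrank ℂ
      (HalfSphere.eigenspace HalfSphere.laplacian (((n : ℂ) / 2) * ((n : ℂ) / 2 + 1))) = n + 1) ∧
    (∀ chat : ℕ → ℕ → ℂ, (∀ n q, ‖chat n q‖ = 1) → ∀ n : ℕ,
      ∃ hY : ∀ q : Fin (n + 1),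
        MemLp (HalfSphere.sphericalHarmonic chat n q) 2 HalfSphere.area,
      Orthonormal ℂ (fun q : Fin (n + 1) => (hY q).toLp) ∧
      Submodule.span ℂ (Set.range fun q : Fin (n + 1) => (hY q).toLp) =
        HalfSphere.eigenspace HalfSphere.laplacian (((n : ℂ) / 2) * ((n : ℂ) / 2 + 1))) ∧
    HalfSphere.IsKthEigenvalue HalfSphere.antisymmetricLaplacian 3 (15 / 4) := by
  have hval (n : ℕ) : (HalfSphere.eigenvalue n : ℂ) = ((n : ℂ) / 2) * ((n : ℂ) / 2 + 1) := by
    rw [HalfSphere.eigenvalue]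
    push_cast
    rfl
  refine ⟨?_, fun n => ?_, fun chat hchat n => ?_,
    HalfSphere.isKthEigenvalue_antisymmetricLaplacian⟩
  · rw [HalfSphere.unboundedSpectrum_laplacian]
    ext z
    simp only [hval, Set.mem_range, Set.mem_ofPred_eq]
    exact exists_congr fun n => eq_comm
  · rw [← hval]
    exact HalfSphere.finrank_eigenspace n
  · refine ⟨fun q => HalfSphere.memLp_sphericalHarmonic hchat (Nat.le_of_lt_succ q.2), ?_, ?_⟩
    · exact (HalfSphere.orthonormal_harmonicFamily hchat).comp
        (fun q : Fin (n + 1) => (⟨n, q⟩ : Σ n : ℕ, Fin (n + 1)))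
        (sigma_mk_injective (β := fun n : ℕ => Fin (n + 1)) (i := n))
    · rw [← hval]
      exact HalfSphere.span_harmonicFamily hchat n
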